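/- Let $\mathbb T=\mathbb R/\mathbb Z$ and let $|\cdot|$ on subsets of $\mathbb T^{d+1}$ denote Lebesgue measure, with $|\mathbb T^{d+1}|=1$. For every integer $d\ge 1$ there is a constant $C>0$, depending only on $d$, such that for every $\varepsilon>0$ there is a constant $C_1>0$, depending only on $d$ and $\varepsilon$, with the following property. Let $N\ge 1$ be an integer, let $S_{d,N}=\{\mathbf n\in\mathbb Z^d: |n_j|\le N,\ 1\le j\le d\}$, let $(a_{\mathbf n})_{\mathbf n\in S_{d,N}}$ be complex numbers with $\sum_{\mathbf n\in S_{d,N}}|a_{\mathbf n}|^2=1$, and put $$F(\mathbf x,t)=\sum_{\mathbf n\in S_{d,N}}a_{\mathbf n}e^{2\pi i\,\mathbf n\cdot\mathbf x}e^{2\pi i|\mathbf n|^2t},\qquad (\mathbf x,t)\in\mathbb T^d\times\mathbb T,$$ where $|\mathbf n|^2=n_1^2+\cdots+n_d^2$. For $\lambda>0$ let $E_\lambda=\{(\mathbf x,t)\in\mathbb T^{d+1}: |F(\mathbf x,t)|>\lambda\}$. Then for every $\lambda\ge C N^{d/4}$, $$|E_\lambda|\le C_1N^{\varepsilon}\lambda^{-\frac{2(d+2)}{d}}.$$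 -/

import Mathlib

open MeasureTheory

namespace SchrodingerRestriction

/-- The frequency box `S_{d,N} = {n ∈ ℤ^d : |n_j| ≤ N for all j}`. -/
noncomputable def box (d N : ℕ) : Finset (Fin d → ℤ) :=
  Fintype.piFinset fun _ => Finset.Icc (-(N : ℤ)) (N : ℤ)

/-- The periodic function
`F(x,t) = ∑_{n ∈ S_{d,N}} a_n e^{2πi n·x} e^{2πi |n|² t}` on `𝕋^d × 𝕋`, with `𝕋 = ℝ/ℤ`. -/
noncomputable def extension (d N : ℕ) (a : (Fin d → ℤ) → ℂ)
    (z : UnitAddTorus (Fin d) × UnitAddCircle) : ℂ :=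
  ∑ n ∈ box d N, a n * UnitAddTorus.mFourier n z.1 * fourier (∑ j, n j ^ 2) z.2

/-- The level set `E_λ = {(x,t) : |F(x,t)| > λ}`, with `lam = λ`. -/
def levelSet (d N : ℕ) (a : (Fin d → ℤ) → ℂ) (lam : ℝ) :
    Set (UnitAddTorus (Fin d) × UnitAddCircle) :=
  {z | lam < ‖extension d N a z‖}

end SchrodingerRestriction

/-! The argument is a circle-method form of the Tomas–Stein duality argument. Put `f = 1_E F/|F|`
with `E = E_λ`. Pairing `f` with `F` and using Cauchy–Schwarz gives `λ²|E|² ≤ ∑ |f̂(n,|n|²)|²`, so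
the sum of the squared coefficients of `f` on the paraboloid must be bounded.

Multiply a smoothed Schrödinger kernel by `majorArc X`, a sum of tents of height and half-width `r =
1/(2X²)` centred at the reduced fractions `a/q` with `X/8 < q ≤ X`, where `X ≥ N`. Two facts carry
the proof. First, the product is at most `r(20000X)^{d/2}` everywhere: the tents have disjoint
supports, and on each of them a log-free Weyl bound holds (`sq_norm_weyl_sum_le_of_close`). Second,
its coefficient at `(n,|n|²+k)` is the cutoff at `n` times the `k`-th coefficient of `majorArc X`.
For `k = 0` the latter is at least a constant times `r`, because there are at least a constant times
`X²` such fractions. For `k ≠ 0` it is `O(r X^{2δ-1})`, by averaging Ramanujan sums and the divisor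
bound (`norm_majorArcCoeff_le`).

In the quadratic form of this kernel at `f`, the sup bound controls the whole form by `‖f‖₁²` and
Bessel controls the terms `k ≠ 0` by `‖f‖₂²`. What remains (`sum_sq_coeff_le`) is `∑ |f̂(n,|n|²)|² ≲
X^{d/2}|E|² + X^{2δ-1}|E|`. Taking `X` to be a small multiple of `λ^{4/d}` absorbs the first term
into `λ²|E|²`, leaving `|E| ≲ X^{2δ-1}λ^{-2}`, which is the claim up to `N^ε`. The hypothesis `λ ≥ C
N^{d/4}` is what makes `X ≥ N`. -/

namespace SchrodingerRestriction

open scoped ComplexConjugate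

/-! ### Fourier series of the periodised tent. -/

/-- Fourier coefficients of the periodised tent function of height `r` and half-width `r`. -/
noncomputable def tentCoeff (r : ℝ) (k : ℤ) : ℝ :=
  (if k = 0 then r ^ 2 else 0) + (Real.sin (Real.pi * k * r) / (Real.pi * k)) ^ 2

lemma tentCoeff_nonneg (r : ℝ) (k : ℤ) : 0 ≤ tentCoeff r k := by
  unfold tentCoeff; split_ifs <;> positivity

lemma tentCoeff_zero (r : ℝ) : tentCoeff r 0 = r ^ 2 := by simp [tentCoeff]

lemma tentCoeff_le_sq (r : ℝ) {k : ℤ} (hk : k ≠ 0) : tentCoeff r k ≤ r ^ 2 := by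
  have hk' : (k : ℝ) ≠ 0 := by exact_mod_cast hk
  have h1 : |Real.sin (Real.pi * k * r)| ≤ |Real.pi * k * r| := Real.abs_sin_le_abs
  simp only [tentCoeff, hk, if_false, zero_add]
  rw [div_pow, div_le_iff₀ (by positivity)]
  calc _ ≤ (Real.pi * k * r) ^ 2 := sq_le_sq.mpr h1
    _ = _ := by ring

lemma tentCoeff_le_inv_sq (r : ℝ) {k : ℤ} (hk : k ≠ 0) : tentCoeff r k ≤ 1 / (k : ℝ) ^ 2 := by
  have hk' : (k : ℝ) ≠ 0 := by exact_mod_cast hk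
  have h1 : Real.sin (Real.pi * k * r) ^ 2 ≤ 1 := Real.sin_sq_le_one _
  have hp : (1 : ℝ) ≤ Real.pi ^ 2 := by nlinarith [Real.pi_gt_three]
  simp only [tentCoeff, hk, if_false, zero_add]
  rw [div_pow, div_le_div_iff₀ (by positivity) (by positivity)]
  have : 0 < (k : ℝ) ^ 2 := by positivity
  rw [mul_pow]
  nlinarith

lemma fourier_real (k : ℤ) (x : ℝ) :
    fourier k (x : UnitAddCircle) = Complex.exp (2 * Real.pi * Complex.I * (k * x : ℝ)) := by
  rw [fourier_coe_apply]; push_cast; congr 1; ring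

lemma fourier_point_add (k : ℤ) (x y : UnitAddCircle) :
    fourier k (x + y) = fourier k x * fourier k y := by
  simp [fourier_apply, smul_add, AddCircle.toCircle_add]

lemma fourier_point_neg (k : ℤ) (x : UnitAddCircle) :
    fourier k (-x) = (starRingEnd ℂ) (fourier k x) := by
  rw [← fourier_neg]; simp [fourier_apply]

lemma norm_fourier_apply (k : ℤ) (x : UnitAddCircle) : ‖fourier k x‖ = 1 := Circle.norm_coe _

lemma four_mul_sin_sq (k : ℤ) (r : ℝ) :
    (2 - fourier k (r : UnitAddCircle) - fourier k (-(r : UnitAddCircle)) : ℂ)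
      = 4 * (Real.sin (Real.pi * k * r) : ℂ) ^ 2 := by
  have h := Complex.two_cos (2 * (Real.pi * k * r : ℝ))
  have h2 := Complex.cos_two_mul (Real.pi * k * r : ℝ)
  have h3 := Complex.sin_sq_add_cos_sq (Real.pi * k * r : ℝ)
  have e1 : fourier k (r : UnitAddCircle) =
      Complex.exp (2 * ((Real.pi * k * r : ℝ) : ℂ) * Complex.I) := by
    rw [fourier_real]; congr 1; push_cast; ring
  have e2 : fourier k (-(r : UnitAddCircle)) =
      Complex.exp (-(2 * ((Real.pi * k * r : ℝ) : ℂ)) * Complex.I) := by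
    rw [← AddCircle.coe_neg, fourier_real]; congr 1; push_cast; ring
  rw [e1, e2, Complex.ofReal_sin]
  linear_combination (1 : ℂ) * h - 2 * h2 - 4 * h3

/-- Since `4 sin²(πkr) = 2 - e(kr) - e(-kr)`, the terms `k ≠ 0` form a second difference of the
Fourier series `∑ e(ky)/k²` of the Bernoulli polynomial `B₂`. That series is known pointwise only on
`[0,1]`, so `z` and `w` are representatives there of `y ± r`. -/
lemma hasSum_tentCoeff_aux {r y z w : ℝ} (hy : y ∈ Set.Icc (0 : ℝ) 1)
    (hz : z ∈ Set.Icc (0 : ℝ) 1) (hw : w ∈ Set.Icc (0 : ℝ) 1)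
    (hzy : (z : UnitAddCircle) = y + r) (hwy : (w : UnitAddCircle) = y + -r) :
    HasSum (fun k : ℤ => (tentCoeff r k : ℂ) * fourier k (y : UnitAddCircle))
      ((r ^ 2 + (2 * bernoulliFun 2 y - bernoulliFun 2 z - bernoulliFun 2 w) / 2 : ℝ) : ℂ) := by
  have hB := fun {x : ℝ} (hx : x ∈ Set.Icc (0 : ℝ) 1) =>
    hasSum_one_div_pow_mul_fourier_mul_bernoulliFun le_rfl hx
  have h := ((((hB hy).mul_left 2).sub (hB hz)).sub (hB hw)).mul_left
    (1 / (4 * (Real.pi : ℂ) ^ 2))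
  have h0 : HasSum (fun k : ℤ => if k = 0 then ((r ^ 2 : ℝ) : ℂ) else 0) ((r ^ 2 : ℝ) : ℂ) :=
    hasSum_ite_eq 0 _
  have hp : (Real.pi : ℂ) ≠ 0 := by exact_mod_cast Real.pi_ne_zero
  convert h0.add h using 1
  · funext k
    rcases eq_or_ne k 0 with rfl | hk
    · simp [tentCoeff_zero]
    have hk' : (k : ℂ) ≠ 0 := by exact_mod_cast hk
    have h4 := four_mul_sin_sq k r
    simp only [tentCoeff, hk, if_false, zero_add, hzy, hwy, fourier_point_add]
    push_cast at h4 ⊢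
    field_simp
    linear_combination (-1 : ℂ) * h4
  · have : (Nat.factorial 2 : ℂ) = 2 := by norm_num
    rw [this]
    push_cast
    field_simp
    ring_nf
    simp only [Complex.I_sq]
    ring

/-- Here `y ± r` do not wrap around, so the second difference of the quadratic `B₂` is the constant
`2r²` and cancels the `k = 0` term. -/
lemma hasSum_tentCoeff_fourier {r y : ℝ} (hr : 0 ≤ r) (hy : r ≤ y) (hy' : y ≤ 1 - r) :
    HasSum (fun k : ℤ => (tentCoeff r k : ℂ) * fourier k (y : UnitAddCircle)) 0 := by
  convert hasSum_tentCoeff_aux (r := r) (y := y) (z := y + r) (w := y - r) ?_ ?_ ?_ ?_ ?_ using 1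
  · simp only [bernoulliFun_two]; norm_cast; ring
  all_goals try (constructor <;> linarith)

/-- The value at the peak `y = 0`; as the coefficients are nonnegative it is also their `ℓ¹` norm,
which yields both summability and the sup bound. -/
lemma hasSum_tentCoeff {r : ℝ} (hr : 0 ≤ r) (hr1 : r ≤ 1) : HasSum (tentCoeff r) r := by
  have h := hasSum_tentCoeff_aux (r := r) (y := 0) (z := r) (w := 1 - r)
    (by simp) ⟨hr, hr1⟩ (by constructor <;> linarith) (by simp)
    (by push_cast; rw [sub_eq_add_neg]; simp)
  rw [← Complex.hasSum_ofReal]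
  convert h using 1
  · funext k; simp
  · simp only [bernoulliFun_two]; congr 1; ring

/-- The periodised tent function, given by its Fourier series. -/
noncomputable def tent (r : ℝ) (t : UnitAddCircle) : ℂ := ∑' k : ℤ, (tentCoeff r k : ℂ) * fourier k t

lemma summable_tentCoeff_fourier {r : ℝ} (hr : 0 ≤ r) (hr1 : r ≤ 1) (t : UnitAddCircle) :
    Summable fun k : ℤ => ‖(tentCoeff r k : ℂ) * fourier k t‖ := by
  refine (hasSum_tentCoeff hr hr1).summable.congr fun k => ?_
  rw [norm_mul, norm_fourier_apply, mul_one, Complex.norm_real, Real.norm_eq_abs,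
    abs_of_nonneg (tentCoeff_nonneg r k)]

lemma norm_tent_le {r : ℝ} (hr : 0 ≤ r) (hr1 : r ≤ 1) (t : UnitAddCircle) : ‖tent r t‖ ≤ r := by
  refine (norm_tsum_le_tsum_norm (summable_tentCoeff_fourier hr hr1 t)).trans_eq ?_
  refine Eq.trans (tsum_congr fun k => ?_) (hasSum_tentCoeff hr hr1).tsum_eq
  rw [norm_mul, norm_fourier_apply, mul_one, Complex.norm_real, Real.norm_eq_abs,
    abs_of_nonneg (tentCoeff_nonneg r k)]

lemma exists_int_abs_sub_lt_of_tent_ne_zero {r y : ℝ} (hr : 0 ≤ r)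
    (h : tent r (y : UnitAddCircle) ≠ 0) : ∃ m : ℤ, |y - m| < r := by
  by_contra! hm
  apply h
  have h0 := hm ⌊y⌋
  have h1 := hm (⌊y⌋ + 1)
  have hf0 := Int.floor_le y
  have hf1 := Int.lt_floor_add_one y
  rw [abs_of_nonneg (by linarith)] at h0
  push_cast at h1
  rw [abs_of_nonpos (by linarith)] at h1
  have hy : (y : UnitAddCircle) = ((y - ⌊y⌋ : ℝ) : UnitAddCircle) := by
    have := (AddCircle.coe_eq_zero_iff (1 : ℝ) (x := (⌊y⌋ : ℝ))).2 ⟨⌊y⌋, by simp⟩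
    rw [AddCircle.coe_sub]
    simp [this]
  rw [hy]
  exact (hasSum_tentCoeff_fourier hr h0 (by linarith)).tsum_eq

/-! ### Triangular weights and summation by parts. -/

/-- The triangular weight `n ↦ max (2N - |n|) 0`. -/
noncomputable def triWeight (N : ℕ) (n : ℤ) : ℝ := max 0 (2 * N - |(n : ℝ)|)

lemma triWeight_nonneg (N : ℕ) (n : ℤ) : 0 ≤ triWeight N n := le_max_left _ _

lemma triWeight_le (N : ℕ) (n : ℤ) : triWeight N n ≤ 2 * N :=
  max_le (by positivity) (by linarith [abs_nonneg (n : ℝ)])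

lemma triWeight_eq_zero {N : ℕ} {n : ℤ} (h : n ∉ Finset.Icc (-(2 * N : ℤ) + 1) (2 * N - 1)) :
    triWeight N n = 0 := by
  apply max_eq_left
  have : (2 * N : ℤ) ≤ |n| := by
    rw [Finset.mem_Icc, not_and_or] at h
    rcases h with h | h
    · exact le_abs.2 (Or.inr (by omega))
    · exact le_abs.2 (Or.inl (by omega))
  have h2 : ((2 * N : ℤ) : ℝ) ≤ ((|n| : ℤ) : ℝ) := by exact_mod_cast this
  push_cast at h2
  linarith

lemma triWeight_of_nonneg {N : ℕ} {n : ℤ} (h0 : 0 ≤ n) (h : n ≤ 2 * N) :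
    triWeight N n = 2 * N - n := by
  have h0' : (0 : ℝ) ≤ n := by exact_mod_cast h0
  have h' : (n : ℝ) ≤ 2 * N := by exact_mod_cast h
  rw [triWeight, abs_of_nonneg h0', max_eq_right (by linarith)]

lemma triWeight_of_nonpos {N : ℕ} {n : ℤ} (h0 : n ≤ 0) (h : -(2 * N : ℤ) ≤ n) :
    triWeight N n = 2 * N + n := by
  have h0' : (n : ℝ) ≤ 0 := by exact_mod_cast h0
  have h' : -(2 * N : ℝ) ≤ n := by exact_mod_cast h
  rw [triWeight, abs_of_nonpos h0', max_eq_right (by linarith)]; ring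

lemma abs_triWeight_sub_le (N : ℕ) (n m : ℤ) :
    |triWeight N n - triWeight N m| ≤ |(n : ℝ) - m| := by
  refine (abs_max_sub_max_le_max _ _ _ _).trans (max_le (by simp) ?_)
  have := abs_abs_sub_abs_le (n : ℝ) m
  rwa [show (2 * (N : ℝ) - |(n : ℝ)|) - (2 * N - |(m : ℝ)|) = -(|(n : ℝ)| - |(m : ℝ)|) by ring, abs_neg]

/-- The centred second difference. -/
def secondDiff (g : ℤ → ℝ) (n : ℤ) : ℝ := g (n + 1) - 2 * g n + g (n - 1)

lemma abs_secondDiff_triWeight_le (N : ℕ) (n : ℤ) :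
    |secondDiff (triWeight N) n| ≤
      (if n = -(2 * N : ℤ) then 2 else 0) + (if n = 0 then 2 else 0) +
        (if n = 2 * N then 2 else 0) := by
  have hle : |secondDiff (triWeight N) n| ≤ 2 := by
    have h1 := abs_triWeight_sub_le N (n + 1) n
    have h2 := abs_triWeight_sub_le N (n - 1) n
    push_cast at h1 h2
    rw [add_sub_cancel_left, abs_one] at h1
    rw [sub_sub_cancel_left, abs_neg, abs_one] at h2
    unfold secondDiff
    rw [abs_le] at h1 h2 ⊢
    constructor <;> linarith
  by_cases h1 : n = -(2 * N : ℤ)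
  · rw [if_pos h1]; split_ifs <;> linarith
  by_cases h2 : n = 0
  · rw [if_pos h2]; split_ifs <;> linarith
  by_cases h3 : n = 2 * N
  · rw [if_pos h3, if_neg h1, if_neg h2]; linarith
  rw [if_neg h1, if_neg h2, if_neg h3]
  refine le_of_eq ?_
  rw [add_zero, add_zero, abs_eq_zero, secondDiff]
  rcases lt_or_ge n (-(2 * N : ℤ)) with h | h
  · rw [triWeight_eq_zero, triWeight_eq_zero, triWeight_eq_zero]
    · ring
    all_goals rw [Finset.mem_Icc]; omega
  rcases lt_or_ge (2 * N : ℤ) n with h' | h'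
  · rw [triWeight_eq_zero, triWeight_eq_zero, triWeight_eq_zero]
    · ring
    all_goals rw [Finset.mem_Icc]; omega
  rcases lt_or_gt_of_ne h2 with h4 | h4
  · rw [triWeight_of_nonpos, triWeight_of_nonpos, triWeight_of_nonpos]
    · push_cast; ring
    all_goals omega
  · rw [triWeight_of_nonneg, triWeight_of_nonneg, triWeight_of_nonneg]
    · push_cast; ring
    all_goals omega

lemma sum_ite_add_eq_le (s : Finset ℤ) (h c : ℤ) :
    ∑ n ∈ s, (if n + h = c then (2 : ℝ) else 0) ≤ 2 := by
  have : ∀ n, (n + h = c) ↔ (n = c - h) := fun n => by omega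
  simp only [this]
  rw [Finset.sum_ite_eq']
  split_ifs <;> norm_num

lemma sum_abs_secondDiff_triWeight_le (N : ℕ) (s : Finset ℤ) (h : ℤ) :
    ∑ n ∈ s, |secondDiff (triWeight N) (n + h)| ≤ 6 := by
  refine (Finset.sum_le_sum fun n _ => abs_secondDiff_triWeight_le N (n + h)).trans ?_
  rw [Finset.sum_add_distrib, Finset.sum_add_distrib]
  linarith [sum_ite_add_eq_le s h (-(2 * N)), sum_ite_add_eq_le s h 0,
    sum_ite_add_eq_le s h (2 * N)]

lemma sum_abs_secondDiff_mul_le {N : ℕ} (hN : 1 ≤ N) (h : ℤ) :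
    ∑ n ∈ Finset.Icc (-(2 * N : ℤ)) (2 * N),
      |secondDiff (fun n => triWeight N n * triWeight N (n + h)) n| ≤ 34 * N := by
  have hN' : (1 : ℝ) ≤ N := by exact_mod_cast hN
  have key : ∀ n : ℤ, |secondDiff (fun n => triWeight N n * triWeight N (n + h)) n| ≤
      2 * N * |secondDiff (triWeight N) (n + h)| + 2 * N * |secondDiff (triWeight N) (n + 0)|
        + 2 := by
    intro n
    -- Discrete Leibniz rule. The last bracket is two products of first differences, each at most 1,
    -- so it costs 2 for each of the `4N+1` values of `n`; the other terms cost `12N` each.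
    have e : secondDiff (fun n => triWeight N n * triWeight N (n + h)) n =
        triWeight N n * secondDiff (triWeight N) (n + h)
        + triWeight N (n + h) * secondDiff (triWeight N) (n + 0)
        + ((triWeight N (n + 1) - triWeight N n) * (triWeight N (n + 1 + h) - triWeight N (n + h))
        + (triWeight N (n - 1) - triWeight N n) *
          (triWeight N (n - 1 + h) - triWeight N (n + h))) := by
      simp only [secondDiff, add_zero, show n + h + 1 = n + 1 + h by ring,
        show n + h - 1 = n - 1 + h by ring]
      ring
    have hd : ∀ m m' : ℤ, |(m : ℝ) - m'| = 1 → |triWeight N m - triWeight N m'| ≤ 1 :=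
      fun m m' hm => (abs_triWeight_sub_le N m m').trans_eq hm
    have p1 := hd (n + 1) n (by push_cast; simp)
    have p2 := hd (n + 1 + h) (n + h) (by push_cast; ring_nf; simp)
    have p3 := hd (n - 1) n (by push_cast; simp)
    have p4 := hd (n - 1 + h) (n + h) (by push_cast; ring_nf; simp)
    rw [e]
    refine (abs_add_le _ _).trans (add_le_add ((abs_add_le _ _).trans (add_le_add ?_ ?_))
      ((abs_add_le _ _).trans ?_))
    · rw [abs_mul, abs_of_nonneg (triWeight_nonneg _ _)]
      exact mul_le_mul_of_nonneg_right (triWeight_le _ _) (abs_nonneg _)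
    · rw [abs_mul, abs_of_nonneg (triWeight_nonneg _ _)]
      exact mul_le_mul_of_nonneg_right (triWeight_le _ _) (abs_nonneg _)
    · rw [abs_mul, abs_mul]
      have := mul_le_one₀ p1 (abs_nonneg _) p2
      have := mul_le_one₀ p3 (abs_nonneg _) p4
      linarith
  refine (Finset.sum_le_sum fun n _ => key n).trans ?_
  rw [Finset.sum_add_distrib, Finset.sum_add_distrib, ← Finset.mul_sum, ← Finset.mul_sum,
    Finset.sum_const, Int.card_Icc]
  have c1 := sum_abs_secondDiff_triWeight_le N (Finset.Icc (-(2 * N : ℤ)) (2 * N)) h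
  have c2 := sum_abs_secondDiff_triWeight_le N (Finset.Icc (-(2 * N : ℤ)) (2 * N)) 0
  have c3 : ((2 * N + 1 - -(2 * N) : ℤ).toNat : ℝ) = 4 * N + 1 := by
    rw [show (2 * N + 1 - -(2 * N) : ℤ) = ((4 * N + 1 : ℕ) : ℤ) by push_cast; ring, Int.toNat_natCast]
    push_cast; ring
  rw [nsmul_eq_mul, c3]
  nlinarith

/-- Two summations by parts: shifting `g` by `±1` multiplies the sum by `e(∓θ)`, so its second
difference multiplies it by `-4 sin²(πθ)`. Vanishing at `±M` keeps the shifted supports inside the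
range. -/
lemma norm_sum_fourier_mul_sin_sq_le (M : ℤ) (g : ℤ → ℝ)
    (hg : ∀ n ∉ Finset.Icc (-M + 1) (M - 1), g n = 0) (θ : ℝ) :
    ‖∑ n ∈ Finset.Icc (-M) M, (g n : ℂ) * fourier n (θ : UnitAddCircle)‖ *
      (4 * Real.sin (Real.pi * θ) ^ 2) ≤ ∑ n ∈ Finset.Icc (-M) M, |secondDiff g n| := by
  set e : ℤ → ℂ := fun n => fourier n (θ : UnitAddCircle) with he
  have hsupp : ∀ j : ℤ, |j| ≤ 1 → ∀ n ∉ Finset.Icc (-M) M, (g (n + j) : ℂ) * e n = 0 := by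
    intro j hj n hn
    rw [abs_le] at hj
    rw [Finset.mem_Icc] at hn
    rw [hg (n + j) (by rw [Finset.mem_Icc]; omega)]
    simp
  have hshift : ∀ j : ℤ, |j| ≤ 1 → ∑ n ∈ Finset.Icc (-M) M, (g (n + j) : ℂ) * e n =
      e (-j) * ∑ n ∈ Finset.Icc (-M) M, (g n : ℂ) * e n := by
    intro j hj
    rw [← tsum_eq_sum (L := .unconditional ℤ) (hsupp j hj)]
    have h0 := hsupp 0 (by simp)
    simp only [add_zero] at h0
    rw [← tsum_eq_sum (L := .unconditional ℤ) h0, ← tsum_mul_left,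
      ← (Equiv.addRight j).tsum_eq (fun n => e (-j) * ((g n : ℂ) * e n))]
    refine tsum_congr fun n => ?_
    rw [Equiv.coe_addRight]
    have : e (n + j) * e (-j) = e n := by
      rw [he]; dsimp only; rw [← fourier_add]; congr 2; ring
    linear_combination (-(g (n + j) : ℂ)) * this
  have h1 := hshift 1 (by simp)
  have h2 := hshift (-1) (by simp)
  have hs : ∑ n ∈ Finset.Icc (-M) M, (secondDiff g n : ℂ) * e n =
      -((4 * Real.sin (Real.pi * θ) ^ 2 : ℝ) : ℂ) *
        ∑ n ∈ Finset.Icc (-M) M, (g n : ℂ) * e n := by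
    have h3 := four_mul_sin_sq 1 θ
    have h4 : e (-1) = fourier 1 (-(θ : UnitAddCircle)) := by
      rw [he]; simp [fourier_apply]
    rw [neg_neg] at h2
    have e1 : ∀ n, (secondDiff g n : ℂ) * e n =
        (g (n + 1) : ℂ) * e n - 2 * ((g n : ℂ) * e n) + (g (n + -1) : ℂ) * e n := by
      intro n; simp only [secondDiff, ← sub_eq_add_neg]; push_cast; ring
    rw [Finset.sum_congr rfl fun n _ => e1 n, Finset.sum_add_distrib, Finset.sum_sub_distrib,
      ← Finset.mul_sum, h1, h2, h4]
    rw [Int.cast_one, mul_one] at h3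
    push_cast at h3 ⊢
    linear_combination (-∑ n ∈ Finset.Icc (-M) M, (g n : ℂ) * e n) * h3
  have hn := norm_sum_le (Finset.Icc (-M) M) fun n => (secondDiff g n : ℂ) * e n
  rw [hs, norm_mul, norm_neg, Complex.norm_real, Real.norm_of_nonneg (by positivity)] at hn
  rw [mul_comm]
  refine hn.trans_eq (Finset.sum_congr rfl fun n _ => ?_)
  rw [norm_mul, norm_fourier_apply, mul_one, Complex.norm_real, Real.norm_eq_abs]

lemma four_mul_sq_sub_round_le (θ : ℝ) : 4 * (θ - round θ) ^ 2 ≤ Real.sin (Real.pi * θ) ^ 2 := by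
  have h := abs_sub_round θ
  have h1 := Real.mul_abs_le_abs_sin (x := Real.pi * (θ - round θ)) (by
    rw [abs_mul, abs_of_pos Real.pi_pos]; nlinarith [Real.pi_pos])
  rw [abs_mul, abs_of_pos Real.pi_pos] at h1
  have h2 : |Real.sin (Real.pi * (θ - round θ))| = |Real.sin (Real.pi * θ)| := by
    rw [mul_sub, mul_comm Real.pi (round θ : ℝ), Real.sin_sub_int_mul_pi, abs_mul]
    simp
  rw [h2, ← mul_assoc, div_mul_cancel₀ _ Real.pi_ne_zero] at h1
  rw [← sq_abs (θ - round θ), ← sq_abs (Real.sin _)]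
  have := abs_nonneg (θ - round θ)
  nlinarith

/-! ### Weyl differencing and the log-free Weyl bound. -/

/-- The correlation sums that appear after squaring a weighted quadratic Weyl sum. -/
noncomputable def correlationSum (N : ℕ) (α : ℝ) (h : ℤ) : ℂ :=
  ∑ n ∈ Finset.Icc (-(2 * N : ℤ)) (2 * N),
    ((triWeight N n * triWeight N (n + h) : ℝ) : ℂ) * fourier n ((2 * h * α : ℝ) : UnitAddCircle)

lemma norm_correlationSum_le {N : ℕ} (hN : 1 ≤ N) (α : ℝ) (h : ℤ) :
    ‖correlationSum N α h‖ ≤ 20 * (N : ℝ) ^ 3 := by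
  have hN' : (1 : ℝ) ≤ N := by exact_mod_cast hN
  rw [correlationSum]
  refine (norm_sum_le _ _).trans ((Finset.sum_le_sum
    (g := fun _ => (2 * (N : ℝ)) * (2 * N)) fun n _ => ?_).trans ?_)
  · rw [norm_mul, norm_fourier_apply, mul_one, Complex.norm_real, Real.norm_of_nonneg
      (mul_nonneg (triWeight_nonneg _ _) (triWeight_nonneg _ _))]
    exact mul_le_mul (triWeight_le _ _) (triWeight_le _ _) (triWeight_nonneg _ _) (by positivity)
  · rw [Finset.sum_const, Int.card_Icc, nsmul_eq_mul,
      show (2 * N + 1 - -(2 * N) : ℤ) = ((4 * N + 1 : ℕ) : ℤ) by push_cast; ring, Int.toNat_natCast]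
    push_cast
    have : (0 : ℝ) ≤ N ^ 2 := by positivity
    nlinarith

/-- The decay is quadratic in the distance from `2hα` to the nearest integer. A sharp cutoff would
give only first-order decay, whose sum over spaced points costs a logarithm. -/
lemma norm_correlationSum_mul_le {N : ℕ} (hN : 1 ≤ N) (α : ℝ) (h : ℤ) :
    ‖correlationSum N α h‖ * (2 * h * α - round (2 * h * α)) ^ 2 ≤ 34 / 16 * N := by
  have h1 := norm_sum_fourier_mul_sin_sq_le (2 * N)
    (fun n => triWeight N n * triWeight N (n + h))
    (fun n hn => by rw [triWeight_eq_zero hn, zero_mul]) (2 * h * α)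
  have h2 := h1.trans (sum_abs_secondDiff_mul_le hN h)
  have h3 := four_mul_sq_sub_round_le (2 * h * α)
  have h4 := mul_le_mul_of_nonneg_left h3 (norm_nonneg (correlationSum N α h))
  change ‖correlationSum N α h‖ * _ ≤ _ at h2
  linarith

/-- After squaring and writing `m = n + h`, the phase is linear in `n` with frequency `2hα`;
everything depending on `β` is a unimodular factor in `h` alone and disappears. -/
lemma sq_norm_weyl_sum_le (N : ℕ) (β : UnitAddCircle) (α : ℝ) :
    ‖∑ n ∈ Finset.Icc (-(2 * N : ℤ)) (2 * N),
      (triWeight N n : ℂ) * fourier n β * fourier (n ^ 2) (α : UnitAddCircle)‖ ^ 2 ≤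
      ∑ h ∈ Finset.Icc (-(4 * N : ℤ)) (4 * N), ‖correlationSum N α h‖ := by
  set A : UnitAddCircle := (α : UnitAddCircle) with hA
  set S := Finset.Icc (-(2 * N : ℤ)) (2 * N) with hS
  set F : ℤ → ℂ := fun n => (triWeight N n : ℂ) * fourier n β * fourier (n ^ 2) A with hF
  have hF0 : ∀ n ∉ Finset.Icc (-(2 * N : ℤ) + 1) (2 * N - 1), F n = 0 := fun n hn => by
    rw [hF]; dsimp only; rw [triWeight_eq_zero hn]; simp
  have hsh : ∀ n ∈ S, ∑ m ∈ S, F m = ∑ h ∈ Finset.Icc (-(4 * N : ℤ)) (4 * N), F (n + h) := by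
    intro n hn
    rw [hS, Finset.mem_Icc] at hn
    rw [← tsum_eq_sum (L := .unconditional ℤ) (f := F) (s := S),
      ← tsum_eq_sum (L := .unconditional ℤ) (f := fun h => F (n + h)),
      ← (Equiv.addLeft n).tsum_eq F]
    · rfl
    · intro h hh
      apply hF0
      rw [Finset.mem_Icc] at hh ⊢
      omega
    · intro h hh
      apply hF0
      rw [hS, Finset.mem_Icc] at hh
      rw [Finset.mem_Icc]
      omega
  have hterm : ∀ n h : ℤ, F (n + h) * (starRingEnd ℂ) (F n) =
      (fourier h β * fourier (h ^ 2) A) *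
        (((triWeight N n * triWeight N (n + h) : ℝ) : ℂ) *
          fourier n ((2 * h * α : ℝ) : UnitAddCircle)) := by
    intro n h
    have e1 : fourier n ((2 * h * α : ℝ) : UnitAddCircle) = fourier (2 * n * h) A := by
      rw [hA, fourier_real, fourier_real]; congr 2; push_cast; ring
    rw [e1]
    simp only [hF, map_mul, ← fourier_neg, Complex.conj_ofReal]
    have e2 : fourier (n + h) β * fourier (-n) β = fourier h β := by
      rw [← fourier_add]; congr 2; ring
    have e3 : fourier ((n + h) ^ 2) A * fourier (-n ^ 2) A =
        fourier (h ^ 2) A * fourier (2 * n * h) A := by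
      rw [← fourier_add, ← fourier_add]; congr 2; ring
    rw [← e2]
    push_cast
    linear_combination ((triWeight N n : ℂ) * (triWeight N (n + h) : ℂ) * fourier (n + h) β *
      fourier (-n) β) * e3
  have hsq : ((‖∑ n ∈ S, F n‖ ^ 2 : ℝ) : ℂ) =
      ∑ h ∈ Finset.Icc (-(4 * N : ℤ)) (4 * N),
        (fourier h β * fourier (h ^ 2) A) * correlationSum N α h := by
    rw [Complex.ofReal_pow, ← Complex.mul_conj', map_sum, Finset.mul_sum]
    rw [Finset.sum_congr rfl fun n hn => by rw [hsh n hn, Finset.sum_mul]]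
    rw [Finset.sum_comm]
    refine Finset.sum_congr rfl fun h _ => ?_
    rw [correlationSum, Finset.mul_sum]
    exact Finset.sum_congr rfl fun n _ => hterm n h
  have hn := norm_sum_le (Finset.Icc (-(4 * N : ℤ)) (4 * N)) fun h =>
    (fourier h β * fourier (h ^ 2) A) * correlationSum N α h
  rw [← hsq, Complex.norm_real, Real.norm_of_nonneg (by positivity)] at hn
  refine hn.trans_eq (Finset.sum_congr rfl fun h _ => ?_)
  rw [norm_mul, norm_mul, norm_fourier_apply, norm_fourier_apply, one_mul, one_mul]

/-- Well-spacing of the points `2hα` modulo one, for `h` in a short range. -/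
lemma spacing {X q : ℕ} (hqX : q ≤ X) (hq : 0 < q) {a : ℤ} (hcop : IsCoprime a (q : ℤ)) {α : ℝ}
    (hα : |α - a / q| < 1 / (2 * (X : ℝ) ^ 2)) {u p : ℤ} (hu : |u| < q)
    (hp : |u * α - p| < 1 / (2 * q)) : u = 0 := by
  have hq' : (0 : ℝ) < q := by exact_mod_cast hq
  have hqX' : (q : ℝ) ≤ X := by exact_mod_cast hqX
  have hu' : |(u : ℝ)| ≤ q := by exact_mod_cast hu.le
  have h1 : |(u : ℝ) * (α - a / q)| ≤ 1 / (2 * q) := by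
    rw [abs_mul]
    calc _ ≤ q * (1 / (2 * (X : ℝ) ^ 2)) := by gcongr
      _ ≤ q * (1 / (2 * (q : ℝ) ^ 2)) := by gcongr
      _ = 1 / (2 * q) := by field_simp
  have h2 : |(u : ℝ) * a / q - p| < 1 / q := by
    have : (u : ℝ) * a / q - p = (u * α - p) - u * (α - a / q) := by ring
    rw [this]
    refine (abs_sub _ _).trans_lt ?_
    have : 1 / (q : ℝ) = 1 / (2 * q) + 1 / (2 * q) := by field_simp; norm_num
    linarith
  have h3 : |((u * a - p * q : ℤ) : ℝ)| < 1 := by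
    have : ((u * a - p * q : ℤ) : ℝ) = ((u : ℝ) * a / q - p) * q := by
      push_cast; field_simp
    rw [this, abs_mul, abs_of_pos hq']
    calc _ < 1 / (q : ℝ) * q := by gcongr
      _ = 1 := by field_simp
  have h4 : u * a - p * q = 0 := Int.abs_lt_one_iff.1 (by exact_mod_cast h3)
  have h5 : (q : ℤ) ∣ u * a := ⟨p, by linarith⟩
  exact Int.eq_zero_of_abs_lt_dvd (hcop.symm.dvd_of_dvd_mul_right h5) hu

/-- A log-free Weyl bound for smoothly weighted quadratic exponential sums. -/
theorem sq_norm_weyl_sum_le_of_close {N X q : ℕ} (hN : 1 ≤ N) (hNX : N ≤ X) (hqX : q ≤ X)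
    (hXq : X < 8 * q) {a : ℤ} (hcop : IsCoprime a (q : ℤ)) {α : ℝ}
    (hα : |α - a / q| < 1 / (2 * (X : ℝ) ^ 2)) (β : UnitAddCircle) :
    ‖∑ n ∈ Finset.Icc (-(2 * N : ℤ)) (2 * N),
      (triWeight N n : ℂ) * fourier n β * fourier (n ^ 2) (α : UnitAddCircle)‖ ^ 2 ≤
      20000 * (N : ℝ) ^ 2 * X := by
  refine (sq_norm_weyl_sum_le N β α).trans ?_
  have hq : 0 < q := by omega
  have hq' : (0 : ℝ) < q := by exact_mod_cast hq
  have hN' : (1 : ℝ) ≤ N := by exact_mod_cast hN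
  have hNX' : (N : ℝ) ≤ X := by exact_mod_cast hNX
  have hqX' : (q : ℝ) ≤ X := by exact_mod_cast hqX
  set δ : ℤ → ℝ := fun h => 2 * h * α - round (2 * h * α) with hδ
  -- Two `h` sharing all three labels have `2h` differing by less than `q` and signed residues `δ`
  -- closer than `1/(2q)`, so `spacing` identifies them. The block index lies in `[-64, 63]` because
  -- `|2h| ≤ 8N ≤ 8X < 64q`.
  set φ : ℤ → ℤ × Bool × ℕ := fun h => (2 * h / q, decide (0 ≤ δ h), ⌊2 * q * |δ h|⌋₊) with hφ
  set T : Finset (ℤ × Bool × ℕ) :=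
    Finset.Icc (-64 : ℤ) 63 ×ˢ (Finset.univ ×ˢ Finset.range (q + 1)) with hT
  -- The trivial bound `20N³` and the decaying bound of order `Nq²/m²` balance at `m` of order
  -- `q/N`.
  set J : ℕ := q / N with hJ
  set G : ℕ → ℝ := fun m => if m ≤ J then 20 * (N : ℝ) ^ 3 else 9 * N * q ^ 2 * ((m : ℝ) ^ 2)⁻¹
    with hG
  have hG0 : ∀ m, 0 ≤ G m := fun m => by rw [hG]; dsimp only; split_ifs <;> positivity
  have hδ2 : ∀ h, |δ h| ≤ 1 / 2 := fun h => abs_sub_round _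
  have hmaps : ∀ h ∈ Finset.Icc (-(4 * N : ℤ)) (4 * N), φ h ∈ T := by
    intro h hh
    rw [Finset.mem_Icc] at hh
    simp only [hφ, hT, Finset.mem_product, Finset.mem_univ, true_and, Finset.mem_Icc,
      Finset.mem_range]
    refine ⟨⟨?_, ?_⟩, ?_⟩
    · rw [Int.le_ediv_iff_mul_le (by exact_mod_cast hq)]; omega
    · rw [← Int.lt_add_one_iff, Int.ediv_lt_iff_lt_mul (by exact_mod_cast hq)]; omega
    · rw [Nat.floor_lt (by positivity)]
      push_cast
      nlinarith [hδ2 h]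
  have hinj : Set.InjOn φ (Finset.Icc (-(4 * N : ℤ)) (4 * N) : Finset ℤ) := by
    intro h _ h' _ heq
    simp only [hφ, Prod.mk.injEq, decide_eq_decide] at heq
    obtain ⟨e1, e2, e3⟩ := heq
    have hu : |2 * h - 2 * h'| < (q : ℤ) := by
      have hqz : (0 : ℤ) < q := by exact_mod_cast hq
      have d1 := Int.emod_add_mul_ediv (2 * h) q
      have d2 := Int.emod_add_mul_ediv (2 * h') q
      have m1 := Int.emod_nonneg (2 * h) hqz.ne'
      have m2 := Int.emod_nonneg (2 * h') hqz.ne'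
      have m3 := Int.emod_lt_of_pos (2 * h) hqz
      have m4 := Int.emod_lt_of_pos (2 * h') hqz
      rw [e1] at d1
      rw [abs_lt]
      constructor <;> linarith
    have hd : |δ h - δ h'| < 1 / (2 * q) := by
      have hab : |δ h - δ h'| = |(|δ h| - |δ h'|)| := by
        by_cases hs : 0 ≤ δ h
        · rw [abs_of_nonneg hs, abs_of_nonneg (e2.1 hs)]
        · rw [abs_of_neg (not_le.1 hs), abs_of_neg (not_le.1 (mt e2.2 hs)), neg_sub_neg,
            abs_sub_comm]
      have f1 := Nat.floor_le (a := 2 * q * |δ h|) (by positivity)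
      have f2 := Nat.lt_floor_add_one (2 * q * |δ h|)
      have f3 := Nat.floor_le (a := 2 * q * |δ h'|) (by positivity)
      have f4 := Nat.lt_floor_add_one (2 * q * |δ h'|)
      rw [e3] at f1 f2
      rw [hab, lt_div_iff₀ (by positivity), ← abs_of_pos (show (0 : ℝ) < 2 * q by positivity),
        ← abs_mul, abs_lt]
      constructor <;> linarith
    have hz := spacing hqX hq hcop hα (u := 2 * h - 2 * h')
      (p := round (2 * h * α) - round (2 * h' * α)) hu (by
        convert hd using 2
        simp only [hδ]; push_cast; ring)
    omega
  have hle : ∀ h, ‖correlationSum N α h‖ ≤ G (φ h).2.2 := by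
    intro h
    simp only [hG, hφ]
    split_ifs with hm
    · exact norm_correlationSum_le hN α h
    · set m := ⌊2 * q * |δ h|⌋₊ with hmdef
      have hm0 : (0 : ℝ) < m := by
        have : 0 < m := (Nat.zero_le J).trans_lt (not_le.1 hm)
        exact_mod_cast this
      have f1 : (m : ℝ) ≤ 2 * q * |δ h| := Nat.floor_le (by positivity)
      have f2 : (m : ℝ) ^ 2 ≤ 4 * q ^ 2 * δ h ^ 2 := by
        calc (m : ℝ) ^ 2 ≤ (2 * q * |δ h|) ^ 2 := by gcongr
          _ = _ := by rw [mul_pow, sq_abs]; ring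
      have f3 := norm_correlationSum_mul_le hN α h
      change _ * δ h ^ 2 ≤ _ at f3
      rw [← div_eq_mul_inv, le_div_iff₀ (by positivity)]
      calc _ ≤ ‖correlationSum N α h‖ * (4 * q ^ 2 * δ h ^ 2) := by gcongr
        _ = 4 * q ^ 2 * (‖correlationSum N α h‖ * δ h ^ 2) := by ring
        _ ≤ 4 * q ^ 2 * (34 / 16 * N) := by gcongr
        _ ≤ _ := by nlinarith [show 0 ≤ (q : ℝ) ^ 2 * N by positivity]
  have hsumG : ∑ m ∈ Finset.range (q + 1), G m ≤ 58 * (N : ℝ) ^ 2 * X := by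
    have hsub : Finset.range (q + 1) ⊆ Finset.range (J + 1) ∪ Finset.Ioo J (q + 1) := by
      intro m hm
      simp only [Finset.mem_union, Finset.mem_range, Finset.mem_Ioo] at hm ⊢
      omega
    refine (Finset.sum_le_sum_of_subset_of_nonneg hsub fun m _ _ => hG0 m).trans ?_
    refine (Finset.sum_union_inter (f := G) ▸ (le_add_of_nonneg_right
      (Finset.sum_nonneg fun m _ => hG0 m)) : _ ≤ _).trans ?_
    have s1 : ∑ m ∈ Finset.range (J + 1), G m = (J + 1) * (20 * (N : ℝ) ^ 3) := by
      have e : ∀ m ∈ Finset.range (J + 1), G m = 20 * (N : ℝ) ^ 3 := fun m hm =>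
        if_pos (Nat.lt_succ_iff.1 (Finset.mem_range.1 hm))
      rw [Finset.sum_congr rfl e]
      simp
    have s2 : ∑ m ∈ Finset.Ioo J (q + 1), G m ≤ 9 * N * q ^ 2 * (2 / (J + 1)) := by
      have e : ∀ m ∈ Finset.Ioo J (q + 1), G m = 9 * N * q ^ 2 * ((m : ℝ) ^ 2)⁻¹ := fun m hm =>
        if_neg (not_le.2 (Finset.mem_Ioo.1 hm).1)
      rw [Finset.sum_congr rfl e, ← Finset.mul_sum]
      gcongr
      exact sum_Ioo_inv_sq_le J (q + 1)
    have hJ1 : (J : ℝ) * N ≤ q := by exact_mod_cast Nat.div_mul_le_self q N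
    have hJ2 : (q : ℝ) ≤ (J + 1) * N := by
      have := (Nat.lt_div_mul_add (a := q) (b := N) (by omega)).le
      have : q ≤ (J + 1) * N := by rw [add_mul, one_mul]; exact this
      exact_mod_cast this
    have s3 : 9 * (N : ℝ) * q ^ 2 * (2 / (J + 1)) ≤ 18 * N ^ 2 * X := by
      rw [← mul_div_assoc, div_le_iff₀ (by positivity)]
      calc 9 * (N : ℝ) * q ^ 2 * 2 = 18 * N * q * q := by ring
        _ ≤ 18 * N * X * ((J + 1) * N) := by gcongr
        _ = _ := by ring
    have s4 : ((J : ℝ) + 1) * (20 * (N : ℝ) ^ 3) ≤ 40 * N ^ 2 * X := by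
      calc ((J : ℝ) + 1) * (20 * (N : ℝ) ^ 3) = 20 * (N : ℝ) ^ 2 * ((J : ℝ) * N + N) := by ring
        _ ≤ 20 * (N : ℝ) ^ 2 * ((X : ℝ) + X) := by gcongr; linarith
        _ = _ := by ring
    linarith
  clear_value T
  have himg : (Finset.Icc (-(4 * N : ℤ)) (4 * N)).image φ ⊆ T := by
    intro p hp
    obtain ⟨h, hh, rfl⟩ := Finset.mem_image.1 hp
    exact hmaps h hh
  calc ∑ h ∈ Finset.Icc (-(4 * N : ℤ)) (4 * N), ‖correlationSum N α h‖
      ≤ ∑ h ∈ Finset.Icc (-(4 * N : ℤ)) (4 * N), G (φ h).2.2 := Finset.sum_le_sum fun h _ => hle h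
    _ = ∑ p ∈ (Finset.Icc (-(4 * N : ℤ)) (4 * N)).image φ, G p.2.2 :=
        (Finset.sum_image (f := fun p => G p.2.2) hinj).symm
    _ ≤ ∑ p ∈ T, G p.2.2 := Finset.sum_le_sum_of_subset_of_nonneg himg fun p _ _ => hG0 _
    -- 128 blocks times 2 signs.
    _ = 256 * ∑ m ∈ Finset.range (q + 1), G m := by
        simp only [hT, Finset.sum_product, Finset.sum_const, Finset.card_univ, Fintype.card_bool,
          Int.card_Icc, nsmul_eq_mul]
        rw [show (63 + 1 - -64 : ℤ).toNat = 128 from rfl]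
        push_cast
        ring
    _ ≤ 20000 * (N : ℝ) ^ 2 * X := by
        have : 0 ≤ (N : ℝ) ^ 2 * X := by positivity
        nlinarith

/-! ### The divisor bound. -/

lemma succ_le_mul_two_pow_rpow {δ : ℝ} (hδ : 0 < δ) (a : ℕ) :
    (a : ℝ) + 1 ≤ (1 + 1 / (δ * Real.log 2)) * ((2 : ℝ) ^ a) ^ δ := by
  have hl : 0 < Real.log 2 := Real.log_pos (by norm_num)
  have e : ((2 : ℝ) ^ a) ^ δ = Real.exp (δ * Real.log 2 * a) := by
    rw [Real.rpow_def_of_pos (by positivity), Real.log_pow]; congr 1; ring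
  have h := Real.add_one_le_exp (δ * Real.log 2 * a)
  rw [e]
  have hL : 0 < δ * Real.log 2 := by positivity
  calc (a : ℝ) + 1 ≤ (1 + 1 / (δ * Real.log 2)) * (δ * Real.log 2 * a + 1) := by
        have : (1 + 1 / (δ * Real.log 2)) * (δ * Real.log 2 * a + 1) =
          a + 1 + (δ * Real.log 2 * a + 1 / (δ * Real.log 2)) := by field_simp; ring
        rw [this]
        have : 0 ≤ δ * Real.log 2 * a + 1 / (δ * Real.log 2) := by positivity
        linarith
    _ ≤ _ := by gcongr

/-- The divisor bound. -/
theorem exists_card_divisors_le {δ : ℝ} (hδ : 0 < δ) :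
    ∃ C : ℝ, 1 ≤ C ∧ ∀ n : ℕ, n ≠ 0 → (n.divisors.card : ℝ) ≤ C * (n : ℝ) ^ δ := by
  have hl : 0 < Real.log 2 := Real.log_pos (by norm_num)
  set K : ℝ := 1 + 1 / (δ * Real.log 2) with hK
  have hK1 : 1 ≤ K := by
    have : 0 < 1 / (δ * Real.log 2) := by positivity
    linarith
  -- Primes `p ≥ P` satisfy `p^δ ≥ 2`, hence `a + 1 ≤ 2^a ≤ p^{aδ}` at no cost; each of the fewer
  -- than `P` smaller primes costs a factor `K`.
  set P : ℕ := ⌈(2 : ℝ) ^ (1 / δ)⌉₊ with hP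
  refine ⟨K ^ P, one_le_pow₀ hK1, fun n hn => ?_⟩
  have hfac : ∀ p ∈ n.primeFactors, ((n.factorization p : ℝ) + 1) ≤
      (if p < P then K else 1) * ((p : ℝ) ^ n.factorization p) ^ δ := by
    intro p hp
    have hp2 : (2 : ℝ) ≤ p := by exact_mod_cast (Nat.prime_of_mem_primeFactors hp).two_le
    split_ifs with hlt
    · refine (succ_le_mul_two_pow_rpow hδ _).trans ?_
      gcongr
    · have hge : (2 : ℝ) ≤ (p : ℝ) ^ δ := by
        have h1 : (2 : ℝ) ^ (1 / δ) ≤ p := (Nat.le_ceil _).trans (by exact_mod_cast not_lt.1 hlt)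
        calc (2 : ℝ) = ((2 : ℝ) ^ (1 / δ)) ^ δ := by
              rw [← Real.rpow_mul (by norm_num), one_div_mul_cancel hδ.ne', Real.rpow_one]
          _ ≤ _ := by gcongr
      rw [one_mul, ← Real.rpow_natCast, ← Real.rpow_mul (by positivity), mul_comm,
        Real.rpow_mul (by positivity), Real.rpow_natCast]
      calc ((n.factorization p : ℝ) + 1) ≤ (2 : ℝ) ^ n.factorization p := by
            exact_mod_cast Nat.lt_two_pow_self
        _ ≤ _ := by gcongr
  have hn' : (n : ℝ) ^ δ = ∏ p ∈ n.primeFactors, ((p : ℝ) ^ n.factorization p) ^ δ := by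
    conv_lhs => rw [← Nat.prod_factorization_pow_eq_self hn]
    rw [Finsupp.prod, Nat.support_factorization, Nat.cast_prod,
      ← Real.finsetProd_rpow _ _ fun p _ => by positivity]
    push_cast
    rfl
  have hc : ∏ p ∈ n.primeFactors, (if p < P then K else 1) ≤ K ^ P := by
    rw [← Finset.prod_filter, Finset.prod_const]
    refine pow_le_pow_right₀ hK1 ?_
    calc _ ≤ (Finset.range P).card := Finset.card_le_card fun p hp => by
          rw [Finset.mem_filter] at hp; exact Finset.mem_range.2 hp.2
      _ = P := Finset.card_range P
  rw [Nat.card_divisors hn, Nat.cast_prod]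
  push_cast
  refine (Finset.prod_le_prod (fun p _ => by positivity) hfac).trans ?_
  rw [Finset.prod_mul_distrib, ← hn']
  gcongr

/-! ### Ramanujan sums and averages of the totient. -/

/-- The Ramanujan sum `c_q(k)`. -/
noncomputable def ramanujanSum (q : ℕ) (k : ℤ) : ℂ :=
  ∑ a ∈ (Finset.range q).filter q.Coprime, fourier k (-((a / q : ℝ) : UnitAddCircle))

lemma norm_sum_range_fourier_le {n : ℕ} (hn : 0 < n) (k : ℤ) :
    ‖∑ b ∈ Finset.range n, fourier k (-((b / n : ℝ) : UnitAddCircle))‖ ≤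
      if (n : ℤ) ∣ k then (n : ℝ) else 0 := by
  have hn' : (n : ℝ) ≠ 0 := by exact_mod_cast hn.ne'
  have hnc : (n : ℂ) ≠ 0 := by exact_mod_cast hn.ne'
  split_ifs with hdvd
  · refine (norm_sum_le _ _).trans ?_
    simp only [norm_fourier_apply]
    simp
  · set ζ : ℂ := fourier k (((-1 / n : ℝ)) : UnitAddCircle) with hζ
    have hpow : ∀ b : ℕ, fourier k (-((b / n : ℝ) : UnitAddCircle)) = ζ ^ b := by
      intro b
      rw [hζ, ← AddCircle.coe_neg, fourier_real, fourier_real, ← Complex.exp_nat_mul]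
      congr 1; push_cast; ring
    have h1 : ζ ≠ 1 := by
      intro h
      rw [hζ, fourier_real, Complex.exp_eq_one_iff] at h
      obtain ⟨m, hm⟩ := h
      apply hdvd
      have hpi := Complex.two_pi_I_ne_zero
      have h2 : (2 * Real.pi * Complex.I) * ((k * (-1 / n) : ℝ) - m : ℂ) = 0 := by
        rw [mul_sub, hm]; ring
      have h3 := (mul_eq_zero.1 h2).resolve_left hpi
      push_cast at h3
      field_simp at h3
      have h4 : (-k - n * m : ℤ) = 0 := by
        have : ((-k - n * m : ℤ) : ℂ) = 0 := by push_cast; linear_combination h3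
        exact_mod_cast this
      exact ⟨-m, by linarith⟩
    have hz : ζ ^ n = 1 := by
      rw [hζ, fourier_real, ← Complex.exp_nat_mul, Complex.exp_eq_one_iff]
      refine ⟨-k, ?_⟩
      push_cast; field_simp
    rw [Finset.sum_congr rfl fun b _ => hpow b, geom_sum_eq h1, hz]
    simp

/-- Möbius inversion removes the coprimality condition, leaving complete sums that vanish unless
their modulus divides `k`. -/
lemma ramanujanSum_eq {q : ℕ} (hq : 0 < q) (k : ℤ) :
    ramanujanSum q k = ∑ e ∈ q.divisors, (ArithmeticFunction.moebius e : ℂ) *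
      ∑ b ∈ Finset.range (q / e), fourier k (-((b / (q / e : ℕ) : ℝ) : UnitAddCircle)) := by
  have hmu : ∀ a : ℕ, (∑ e ∈ q.divisors, if e ∣ a then (ArithmeticFunction.moebius e : ℂ) else 0) =
      if q.Coprime a then 1 else 0 := by
    intro a
    have h := congrArg (fun f => f (q.gcd a)) ArithmeticFunction.moebius_mul_coe_zeta
    simp only [ArithmeticFunction.coe_mul_zeta_apply, ArithmeticFunction.one_apply] at h
    have h' := congrArg (fun z : ℤ => (z : ℂ)) h
    push_cast at h'
    rw [← Finset.sum_filter]
    refine (Finset.sum_congr ?_ fun _ _ => rfl).trans h'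
    ext e
    simp only [Finset.mem_filter, Nat.mem_divisors, Nat.dvd_gcd_iff]
    have : q.gcd a ≠ 0 := Nat.gcd_ne_zero_left hq.ne'
    have := hq.ne'
    tauto
  rw [ramanujanSum, Finset.sum_filter]
  have h1 : ∀ a ∈ Finset.range q,
      (if q.Coprime a then fourier k (-((a / q : ℝ) : UnitAddCircle)) else 0) =
      ∑ e ∈ q.divisors, if e ∣ a then (ArithmeticFunction.moebius e : ℂ) *
        fourier k (-((a / q : ℝ) : UnitAddCircle)) else 0 := by
    intro a _
    rw [← one_mul (fourier k _), ← zero_mul (fourier k (-((a / q : ℝ) : UnitAddCircle))),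
      ← ite_mul, ← hmu, Finset.sum_mul]
    refine Finset.sum_congr rfl fun e _ => ?_
    split_ifs <;> simp
  rw [Finset.sum_congr rfl h1, Finset.sum_comm]
  refine Finset.sum_congr rfl fun e he => ?_
  have hed := (Nat.mem_divisors.1 he).1
  have he0 : 0 < e := Nat.pos_of_dvd_of_pos hed hq
  obtain ⟨f, rfl⟩ := hed
  have hf0 : 0 < f := Nat.pos_of_mul_pos_left hq
  rw [Nat.mul_div_cancel_left _ he0, ← Finset.sum_filter, Finset.mul_sum]
  symm
  refine Finset.sum_nbij' (fun b => e * b) (fun a => a / e) ?_ ?_ ?_ ?_ ?_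
  · intro b hb
    simp only [Finset.mem_filter, Finset.mem_range] at hb ⊢
    exact ⟨Nat.mul_lt_mul_of_pos_left hb he0, dvd_mul_right _ _⟩
  · intro a ha
    simp only [Finset.mem_filter, Finset.mem_range] at ha ⊢
    exact Nat.div_lt_of_lt_mul ha.1
  · intro b _
    exact Nat.mul_div_cancel_left _ he0
  · intro a ha
    simp only [Finset.mem_filter] at ha
    exact Nat.mul_div_cancel' ha.2
  · intro b _
    congr 4
    have : (e : ℝ) ≠ 0 := by exact_mod_cast he0.ne'
    push_cast
    rw [mul_div_mul_left _ _ this]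

lemma norm_ramanujanSum_le {q : ℕ} (hq : 0 < q) (k : ℤ) :
    ‖ramanujanSum q k‖ ≤ ∑ d ∈ q.divisors, if (d : ℤ) ∣ k then (d : ℝ) else 0 := by
  rw [ramanujanSum_eq hq, ← Nat.sum_div_divisors q fun d => if (d : ℤ) ∣ k then (d : ℝ) else 0]
  refine norm_sum_le_of_le _ fun e he => ?_
  have hed := (Nat.mem_divisors.1 he).1
  have hpos : 0 < q / e := Nat.div_pos (Nat.le_of_dvd hq hed) (Nat.pos_of_dvd_of_pos hed hq)
  rw [norm_mul]
  have h1 : ‖(ArithmeticFunction.moebius e : ℂ)‖ ≤ 1 := by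
    rw [Complex.norm_intCast]
    exact_mod_cast ArithmeticFunction.abs_moebius_le_one
  calc _ ≤ 1 * _ := mul_le_mul_of_nonneg_right h1 (norm_nonneg _)
    _ ≤ _ := by rw [one_mul]; exact norm_sum_range_fourier_le hpos k

/-- Each `d ∣ k` contributes `d` for each of the `⌊X/d⌋` multiples `q ≤ X`, so at most `X`. This
averaging over `q` gains a factor `X` over the count of fractions. -/
lemma sum_norm_ramanujanSum_le (X : ℕ) {k : ℤ} (hk : k ≠ 0) :
    ∑ q ∈ Finset.Ioc 0 X, ‖ramanujanSum q k‖ ≤ X * (k.natAbs.divisors.card : ℝ) := by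
  have hk' : k.natAbs ≠ 0 := Int.natAbs_ne_zero.2 hk
  calc ∑ q ∈ Finset.Ioc 0 X, ‖ramanujanSum q k‖
      ≤ ∑ q ∈ Finset.Ioc 0 X, ∑ d ∈ k.natAbs.divisors, if d ∣ q then (d : ℝ) else 0 := by
        refine Finset.sum_le_sum fun q hq => ?_
        have hq0 := (Finset.mem_Ioc.1 hq).1
        refine (norm_ramanujanSum_le hq0 k).trans_eq ?_
        rw [← Finset.sum_filter, ← Finset.sum_filter]
        refine Finset.sum_congr ?_ fun _ _ => rfl
        ext d
        simp only [Finset.mem_filter, Nat.mem_divisors, Int.natCast_dvd]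
        have := hq0.ne'
        tauto
    _ = ∑ d ∈ k.natAbs.divisors, (d : ℝ) * ((X / d : ℕ) : ℝ) := by
        rw [Finset.sum_comm]
        refine Finset.sum_congr rfl fun d _ => ?_
        rw [← Finset.sum_filter, Finset.sum_const, Nat.Ioc_filter_dvd_card_eq_div, nsmul_eq_mul,
          mul_comm]
    _ ≤ ∑ d ∈ k.natAbs.divisors, (X : ℝ) :=
        Finset.sum_le_sum fun d _ => by exact_mod_cast Nat.mul_div_le X d
    _ = _ := by rw [Finset.sum_const, nsmul_eq_mul, mul_comm]

lemma sum_totient_mul_div (X : ℕ) :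
    ∑ q ∈ Finset.Ioc 0 X, q.totient * (X / q) = ∑ n ∈ Finset.Ioc 0 X, n := by
  have : ∀ n ∈ Finset.Ioc 0 X, n = ∑ q ∈ Finset.Ioc 0 X, if q ∣ n then q.totient else 0 := by
    intro n hn
    rw [Finset.mem_Ioc] at hn
    conv_lhs => rw [← Nat.sum_totient n]
    rw [← Finset.sum_filter]
    refine Finset.sum_congr ?_ fun _ _ => rfl
    ext d
    simp only [Finset.mem_filter, Nat.mem_divisors, Finset.mem_Ioc]
    constructor
    · rintro ⟨h, -⟩
      exact ⟨⟨Nat.pos_of_dvd_of_pos h hn.1, (Nat.le_of_dvd hn.1 h).trans hn.2⟩, h⟩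
    · rintro ⟨-, h⟩
      exact ⟨h, hn.1.ne'⟩
  rw [Finset.sum_congr rfl this, Finset.sum_comm]
  refine Finset.sum_congr rfl fun q _ => ?_
  rw [← Finset.sum_filter, Finset.sum_const, Nat.Ioc_filter_dvd_card_eq_div, smul_eq_mul, mul_comm]

/-- Start from `∑ φ(q)⌊X/q⌋ = ∑ n ≥ X²/2`. The range `q ≤ X/8` contributes at most `X²/8`, since
each term is at most `X`; on the rest `⌊X/q⌋ ≤ 8`. -/
lemma sq_le_sum_totient (X : ℕ) :
    3 * X ^ 2 ≤ 64 * ∑ q ∈ (Finset.Ioc 0 X).filter (fun q => X < 8 * q), q.totient := by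
  have h0 : X ^ 2 ≤ 2 * ∑ n ∈ Finset.Ioc 0 X, n := by
    have : ∀ Y : ℕ, Y ^ 2 ≤ 2 * ∑ n ∈ Finset.Ioc 0 Y, n := by
      intro Y
      induction Y with
      | zero => simp
      | succ Y ih =>
        rw [Finset.sum_Ioc_succ_top (Nat.zero_le Y)]
        nlinarith
    exact this X
  rw [← sum_totient_mul_div, ← Finset.sum_filter_add_sum_filter_not _ (fun q => X < 8 * q)] at h0
  have h1 : ∑ q ∈ (Finset.Ioc 0 X).filter (fun q => X < 8 * q), q.totient * (X / q) ≤
      8 * ∑ q ∈ (Finset.Ioc 0 X).filter (fun q => X < 8 * q), q.totient := by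
    rw [Finset.mul_sum]
    refine Finset.sum_le_sum fun q hq => ?_
    rw [mul_comm]
    refine Nat.mul_le_mul_right _ ?_
    simp only [Finset.mem_filter, Finset.mem_Ioc] at hq
    exact (Nat.div_lt_of_lt_mul (by linarith [hq.2])).le
  have h2 : ∑ q ∈ (Finset.Ioc 0 X).filter (fun q => ¬ X < 8 * q), q.totient * (X / q) ≤
      X / 8 * X := by
    calc _ ≤ ∑ q ∈ (Finset.Ioc 0 X).filter (fun q => ¬ X < 8 * q), X := by
          refine Finset.sum_le_sum fun q _ => ?_
          exact (Nat.mul_le_mul_right _ (Nat.totient_le q)).trans (Nat.mul_div_le X q)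
      _ ≤ ∑ q ∈ Finset.Ioc 0 (X / 8), X := by
          refine Finset.sum_le_sum_of_subset fun q hq => ?_
          simp only [Finset.mem_filter, Finset.mem_Ioc] at hq ⊢
          omega
      _ = _ := by simp
  have h3 : 8 * (X / 8 * X) ≤ X ^ 2 := by
    have := Nat.mul_div_le X 8
    nlinarith
  nlinarith

/-! ### Farey fractions and the major arc function. -/

/-- Reduced fractions `a / q` with `X / 8 < q ≤ X`. -/
def farey (X : ℕ) : Finset (Σ _ : ℕ, ℕ) :=
  ((Finset.Ioc 0 X).filter (fun q => X < 8 * q)).sigma fun q => (Finset.range q).filter q.Coprime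

lemma mem_farey {X : ℕ} {p : Σ _ : ℕ, ℕ} :
    p ∈ farey X ↔ ((0 < p.1 ∧ p.1 ≤ X) ∧ X < 8 * p.1) ∧ p.2 < p.1 ∧ p.1.Coprime p.2 := by
  simp [farey]

/-- The exponential sum over the fractions in `farey X`. -/
noncomputable def fareySum (X : ℕ) (k : ℤ) : ℂ :=
  ∑ p ∈ farey X, fourier k (-((p.2 / p.1 : ℝ) : UnitAddCircle))

lemma fareySum_eq (X : ℕ) (k : ℤ) :
    fareySum X k = ∑ q ∈ (Finset.Ioc 0 X).filter (fun q => X < 8 * q), ramanujanSum q k := by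
  rw [fareySum, farey, Finset.sum_sigma]; rfl

lemma norm_fareySum_le_card (X : ℕ) (k : ℤ) : ‖fareySum X k‖ ≤ (farey X).card := by
  refine (norm_sum_le _ _).trans ?_
  simp only [norm_fourier_apply]
  simp

lemma norm_fareySum_le (X : ℕ) {k : ℤ} (hk : k ≠ 0) :
    ‖fareySum X k‖ ≤ X * (k.natAbs.divisors.card : ℝ) := by
  rw [fareySum_eq]
  refine (norm_sum_le _ _).trans (le_trans ?_ (sum_norm_ramanujanSum_le X hk))
  exact Finset.sum_le_sum_of_subset_of_nonneg (Finset.filter_subset _ _)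
    fun _ _ _ => norm_nonneg _

lemma fareySum_zero (X : ℕ) : fareySum X 0 = ((farey X).card : ℝ) := by
  simp [fareySum]

lemma three_mul_sq_le_card_farey (X : ℕ) : 3 * (X : ℝ) ^ 2 ≤ 64 * ((farey X).card : ℝ) := by
  have h := sq_le_sum_totient X
  have : (farey X).card = ∑ q ∈ (Finset.Ioc 0 X).filter (fun q => X < 8 * q), q.totient := by
    rw [farey, Finset.card_sigma]; rfl
  rw [← this] at h
  exact_mod_cast h

/-- Half-width of the major arcs of level `X`. -/
noncomputable def arcWidth (X : ℕ) : ℝ := 1 / (2 * (X : ℝ) ^ 2)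

lemma arcWidth_pos {X : ℕ} (hX : 1 ≤ X) : 0 < arcWidth X := by
  have : (1 : ℝ) ≤ X := by exact_mod_cast hX
  unfold arcWidth; positivity

lemma arcWidth_le_one {X : ℕ} (hX : 1 ≤ X) : arcWidth X ≤ 1 := by
  have : (1 : ℝ) ≤ X := by exact_mod_cast hX
  unfold arcWidth
  rw [div_le_one (by positivity)]
  nlinarith

/-- Sum of tents centred at the fractions in `farey X`. -/
noncomputable def majorArc (X : ℕ) (t : UnitAddCircle) : ℂ :=
  ∑ p ∈ farey X, tent (arcWidth X) (t - ((p.2 / p.1 : ℝ) : UnitAddCircle))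

/-- Fourier coefficients of `majorArc X`. -/
noncomputable def majorArcCoeff (X : ℕ) (k : ℤ) : ℂ := tentCoeff (arcWidth X) k * fareySum X k

lemma hasSum_majorArc {X : ℕ} (hX : 1 ≤ X) (t : UnitAddCircle) :
    HasSum (fun k : ℤ => majorArcCoeff X k * fourier k t) (majorArc X t) := by
  have h : ∀ p ∈ farey X, HasSum (fun k : ℤ => (tentCoeff (arcWidth X) k : ℂ) *
      fourier k (t - ((p.2 / p.1 : ℝ) : UnitAddCircle)))
      (tent (arcWidth X) (t - ((p.2 / p.1 : ℝ) : UnitAddCircle))) := fun p _ =>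
    (summable_tentCoeff_fourier (arcWidth_pos hX).le (arcWidth_le_one hX) _).of_norm.hasSum
  rw [majorArc]
  convert hasSum_sum h using 1
  funext k
  rw [majorArcCoeff, fareySum, Finset.mul_sum, Finset.sum_mul]
  refine Finset.sum_congr rfl fun p _ => ?_
  rw [sub_eq_add_neg, fourier_point_add]
  ring

lemma exists_close_of_tent_ne_zero {X : ℕ} (hX : 1 ≤ X) {p : Σ _ : ℕ, ℕ} (hp : p ∈ farey X) {α : ℝ}
    (h : tent (arcWidth X) ((α : UnitAddCircle) - ((p.2 / p.1 : ℝ) : UnitAddCircle)) ≠ 0) :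
    ∃ m : ℤ, |α - ((p.2 + m * p.1 : ℤ) : ℝ) / p.1| < arcWidth X := by
  rw [← AddCircle.coe_sub] at h
  obtain ⟨m, hm⟩ := exists_int_abs_sub_lt_of_tent_ne_zero (arcWidth_pos hX).le h
  refine ⟨m, ?_⟩
  have hp0 : (p.1 : ℝ) ≠ 0 := by
    have := (mem_farey.1 hp).1.1.1
    exact_mod_cast this.ne'
  convert hm using 2
  push_cast
  field_simp
  ring

/-- Distinct fractions with denominators at most `X` differ by at least `1/X²`, twice the
half-width, so the arcs are disjoint. The integers `m`, `m'` account for working modulo 1. -/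
lemma farey_eq_of_close {X : ℕ} {p p' : Σ _ : ℕ, ℕ} (hp : p ∈ farey X) (hp' : p' ∈ farey X)
    {α : ℝ} {m m' : ℤ} (h : |α - ((p.2 + m * p.1 : ℤ) : ℝ) / p.1| < arcWidth X)
    (h' : |α - ((p'.2 + m' * p'.1 : ℤ) : ℝ) / p'.1| < arcWidth X) : p = p' := by
  obtain ⟨q, a⟩ := p
  obtain ⟨q', a'⟩ := p'
  rw [mem_farey] at hp hp'
  dsimp only at *
  obtain ⟨⟨⟨hq0, hqX⟩, -⟩, ha, hc⟩ := hp
  obtain ⟨⟨⟨hq0', hqX'⟩, -⟩, ha', hc'⟩ := hp'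
  have hq : (0 : ℝ) < q := by exact_mod_cast hq0
  have hq' : (0 : ℝ) < q' := by exact_mod_cast hq0'
  have hX : (q : ℝ) ≤ X := by exact_mod_cast hqX
  have hX' : (q' : ℝ) ≤ X := by exact_mod_cast hqX'
  have hXp : (0 : ℝ) < X := hq.trans_le hX
  set b : ℤ := a + m * q with hb
  set b' : ℤ := a' + m' * q' with hb'
  have h1 : |(b : ℝ) / q - b' / q'| < 1 / (X : ℝ) ^ 2 := by
    have e : (b : ℝ) / q - b' / q' = (α - b' / q') - (α - b / q) := by ring
    rw [e]
    refine (abs_sub _ _).trans_lt ?_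
    have : 1 / (X : ℝ) ^ 2 = arcWidth X + arcWidth X := by unfold arcWidth; field_simp; norm_num
    linarith
  have h2 : |((b * q' - b' * q : ℤ) : ℝ)| < 1 := by
    have e : ((b * q' - b' * q : ℤ) : ℝ) = ((b : ℝ) / q - b' / q') * (q * q') := by
      push_cast; field_simp
    rw [e, abs_mul, abs_of_pos (by positivity : (0 : ℝ) < q * q')]
    calc _ < 1 / (X : ℝ) ^ 2 * (q * q') := by gcongr
      _ ≤ 1 / (X : ℝ) ^ 2 * (X * X) := by gcongr
      _ = 1 := by field_simp
  have h3 : b * q' - b' * q = 0 := Int.abs_lt_one_iff.1 (by exact_mod_cast h2)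
  have cb : IsCoprime (q : ℤ) b := by
    rw [hb, IsCoprime.add_mul_right_right_iff]
    exact Nat.isCoprime_iff_coprime.2 hc
  have cb' : IsCoprime (q' : ℤ) b' := by
    rw [hb', IsCoprime.add_mul_right_right_iff]
    exact Nat.isCoprime_iff_coprime.2 hc'
  have d1 : (q : ℤ) ∣ q' := cb.dvd_of_dvd_mul_left ⟨b', by linarith⟩
  have d2 : (q' : ℤ) ∣ q := cb'.dvd_of_dvd_mul_left ⟨b, by linarith⟩
  have e1 : q = q' := Nat.dvd_antisymm (by exact_mod_cast d1) (by exact_mod_cast d2)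
  subst e1
  have hqz : (0 : ℤ) < q := by exact_mod_cast hq0
  have e2 : b = b' := by
    have : (b - b') * q = 0 := by linarith
    rcases mul_eq_zero.1 this with h4 | h4
    · linarith
    · omega
  have e3 : a = a' := by
    have h5 : (a : ℤ) % q = (a' : ℤ) % q := by
      have := congrArg (· % (q : ℤ)) e2
      simpa [hb, hb'] using this
    rw [Int.emod_eq_of_lt (by omega) (by omega), Int.emod_eq_of_lt (by omega) (by omega)] at h5
    exact_mod_cast h5
  rw [e3]

lemma majorArc_eq_zero_or {X : ℕ} (hX : 1 ≤ X) (α : ℝ) :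
    majorArc X (α : UnitAddCircle) = 0 ∨
      ‖majorArc X (α : UnitAddCircle)‖ ≤ arcWidth X ∧
      ∃ (q : ℕ) (a : ℤ), q ≤ X ∧ X < 8 * q ∧ IsCoprime a (q : ℤ) ∧
        |α - a / q| < 1 / (2 * (X : ℝ) ^ 2) := by
  by_cases hz : ∀ p ∈ farey X,
      tent (arcWidth X) ((α : UnitAddCircle) - ((p.2 / p.1 : ℝ) : UnitAddCircle)) = 0
  · exact Or.inl (Finset.sum_eq_zero hz)
  push Not at hz
  obtain ⟨p, hp, hne⟩ := hz
  obtain ⟨m, hm⟩ := exists_close_of_tent_ne_zero hX hp hne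
  refine Or.inr ⟨?_, p.1, p.2 + m * p.1, ?_, ?_, ?_, hm⟩
  · rw [majorArc, Finset.sum_eq_single_of_mem p hp]
    · exact norm_tent_le (arcWidth_pos hX).le (arcWidth_le_one hX) _
    · intro p' hp' hpp'
      by_contra hne'
      obtain ⟨m', hm'⟩ := exists_close_of_tent_ne_zero hX hp' hne'
      exact hpp' (farey_eq_of_close hp' hp hm' hm)
  · exact (mem_farey.1 hp).1.1.2
  · exact (mem_farey.1 hp).1.2
  · rw [isCoprime_comm, IsCoprime.add_mul_right_right_iff]
    exact Nat.isCoprime_iff_coprime.2 (mem_farey.1 hp).2.2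

/-- Truncation keeps the later quadratic form and Bessel's inequality finite; `0 ∈ s` keeps the main
frequency in the truncated sum. -/
lemma exists_finset_approx_majorArc {X : ℕ} (hX : 1 ≤ X) {δ : ℝ} (hδ : 0 < δ) :
    ∃ s : Finset ℤ, 0 ∈ s ∧ ∀ t : UnitAddCircle,
      ‖majorArc X t - ∑ k ∈ s, majorArcCoeff X k * fourier k t‖ < δ := by
  have hu : Summable fun k : ℤ => tentCoeff (arcWidth X) k * (farey X).card :=
    (hasSum_tentCoeff (arcWidth_pos hX).le (arcWidth_le_one hX)).summable.mul_right _
  have h := tendstoUniformly_tsum hu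
    (f := fun (k : ℤ) (t : UnitAddCircle) => majorArcCoeff X k * fourier k t) (fun k t => by
      rw [norm_mul, norm_fourier_apply, mul_one, majorArcCoeff, norm_mul, Complex.norm_real,
        Real.norm_of_nonneg (tentCoeff_nonneg _ _)]
      exact mul_le_mul_of_nonneg_left (norm_fareySum_le_card X k) (tentCoeff_nonneg _ _))
  obtain ⟨s, hs, h0⟩ := ((Metric.tendstoUniformly_iff.1 h δ hδ).and
    (Filter.eventually_ge_atTop {0})).exists
  refine ⟨s, h0 (Finset.mem_singleton_self 0), fun t => ?_⟩
  have := hs t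
  rwa [dist_eq_norm, (hasSum_majorArc hX t).tsum_eq] at this

lemma majorArcCoeff_zero (X : ℕ) :
    majorArcCoeff X 0 = ((arcWidth X ^ 2 * (farey X).card : ℝ) : ℂ) := by
  rw [majorArcCoeff, tentCoeff_zero, fareySum_zero]; push_cast; rfl

lemma le_arcWidth_sq_mul_card {X : ℕ} (hX : 1 ≤ X) :
    3 / 128 * arcWidth X ≤ arcWidth X ^ 2 * (farey X).card := by
  have h := three_mul_sq_le_card_farey X
  have hX' : (1 : ℝ) ≤ X := by exact_mod_cast hX
  have : 3 / 128 ≤ arcWidth X * (farey X).card := by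
    rw [arcWidth, div_mul_eq_mul_div, one_mul, le_div_iff₀ (by positivity)]
    linarith
  nlinarith [arcWidth_pos hX]

/-- For `|k| ≤ X²` the tent coefficient is at most `r²` and `|k|^δ` at most `X^{2δ}`. For larger
`|k|` the decay `1/k²` beats the divisor bound, `|k|^{δ-1}` being nonincreasing as `δ ≤ 1`. -/
lemma norm_majorArcCoeff_le {δ C : ℝ} (hδ : 0 < δ) (hδ1 : δ ≤ 1)
    (hC : ∀ n : ℕ, n ≠ 0 → (n.divisors.card : ℝ) ≤ C * (n : ℝ) ^ δ) {X : ℕ} (hX : 1 ≤ X)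
    {k : ℤ} (hk : k ≠ 0) :
    ‖majorArcCoeff X k‖ ≤ arcWidth X * (2 * C * ((X : ℝ) ^ 2) ^ δ / X) := by
  have hX' : (1 : ℝ) ≤ X := by exact_mod_cast hX
  have hX0 : (0 : ℝ) < X := by linarith
  have hr := arcWidth_pos hX
  have hkn : k.natAbs ≠ 0 := Int.natAbs_ne_zero.2 hk
  set K : ℝ := (k.natAbs : ℝ) with hK
  have hK1 : 1 ≤ K := by rw [hK]; exact_mod_cast Nat.one_le_iff_ne_zero.2 hkn
  have hK0 : 0 < K := by linarith
  have hKk : (k : ℝ) ^ 2 = K ^ 2 := by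
    rw [hK, Nat.cast_natAbs, Int.cast_abs, sq_abs]
  have hC0 : 0 ≤ C := by
    have := hC 1 one_ne_zero
    simp at this
    linarith
  have h1 : ‖majorArcCoeff X k‖ ≤ tentCoeff (arcWidth X) k * (X * (C * K ^ δ)) := by
    rw [majorArcCoeff, norm_mul, Complex.norm_real, Real.norm_of_nonneg (tentCoeff_nonneg _ _)]
    refine mul_le_mul_of_nonneg_left ((norm_fareySum_le X hk).trans ?_) (tentCoeff_nonneg _ _)
    exact mul_le_mul_of_nonneg_left (hC _ hkn) hX0.le
  refine h1.trans ?_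
  rcases le_total K ((X : ℝ) ^ 2) with hle | hle
  · calc tentCoeff (arcWidth X) k * (X * (C * K ^ δ))
        ≤ arcWidth X ^ 2 * (X * (C * ((X : ℝ) ^ 2) ^ δ)) := by
          gcongr
          exact tentCoeff_le_sq _ hk
      _ = arcWidth X * (C / 2 * ((X : ℝ) ^ 2) ^ δ / X) := by
          have : arcWidth X ^ 2 = arcWidth X * (1 / (2 * (X : ℝ) ^ 2)) := by
            rw [sq]; rfl
          rw [this]; field_simp
      _ ≤ _ := by gcongr; linarith
  · have hpow : K ^ δ / K ≤ ((X : ℝ) ^ 2) ^ δ / X ^ 2 := by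
      rw [← Real.rpow_sub_one hK0.ne', ← Real.rpow_sub_one (by positivity)]
      exact Real.rpow_le_rpow_of_nonpos (by positivity) hle (by linarith)
    calc tentCoeff (arcWidth X) k * (X * (C * K ^ δ))
        ≤ 1 / K ^ 2 * (X * (C * K ^ δ)) := by
          gcongr
          exact (tentCoeff_le_inv_sq _ hk).trans_eq (by rw [hKk])
      _ = C * X * (1 / K) * (K ^ δ / K) := by field_simp
      _ ≤ C * X * (1 / X ^ 2) * (((X : ℝ) ^ 2) ^ δ / X ^ 2) := by gcongr
      _ = _ := by unfold arcWidth; field_simp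

/-! ### Bessel's inequality and quadratic forms with bounded kernel. -/

section Bessel

variable {Z ι : Type*} [MeasurableSpace Z] {μ : Measure Z}

lemma inner_toLp_eq {f g : Z → ℂ} (hf : MemLp f 2 μ) (hg : MemLp g 2 μ) :
    inner ℂ (hf.toLp f) (hg.toLp g) = ∫ z, conj (f z) * g z ∂μ := by
  rw [L2.inner_def]
  refine integral_congr_ae ?_
  filter_upwards [hf.coeFn_toLp, hg.coeFn_toLp] with z h1 h2
  rw [h1, h2, RCLike.inner_apply, mul_comm]

variable [IsProbabilityMeasure μ]

/-- Bessel's inequality for a finite orthonormal family of unimodular functions. -/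
lemma sum_sq_norm_integral_le (s : Finset ι) {χ : ι → Z → ℂ} (hχ : ∀ i, Measurable (χ i))
    (hχ1 : ∀ i z, ‖χ i z‖ = 1)
    (horth : ∀ i ∈ s, ∀ j ∈ s, i ≠ j → ∫ z, conj (χ i z) * χ j z ∂μ = 0)
    {f : Z → ℂ} (hf : Measurable f) (hf1 : ∀ z, ‖f z‖ ≤ 1) :
    ∑ i ∈ s, ‖∫ z, conj (χ i z) * f z ∂μ‖ ^ 2 ≤ ∫ z, ‖f z‖ ^ 2 ∂μ := by
  classical
  have hfL : MemLp f 2 μ := MemLp.of_bound hf.aestronglyMeasurable 1 (.of_forall hf1)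
  have hχL : ∀ i, MemLp (χ i) 2 μ := fun i =>
    MemLp.of_bound (hχ i).aestronglyMeasurable 1 (.of_forall fun z => (hχ1 i z).le)
  have hon : Orthonormal ℂ (fun i : s => (hχL i).toLp (χ i)) := by
    rw [orthonormal_iff_ite]
    intro i j
    rw [inner_toLp_eq]
    split_ifs with h
    · subst h
      have : ∀ z, conj (χ i z) * χ i z = 1 := fun z => by
        rw [Complex.conj_mul', hχ1]; simp
      simp [this]
    · exact horth i i.2 j j.2 fun h' => h (Subtype.ext h')
  have hB := hon.sum_inner_products_le (hfL.toLp f) (s := Finset.univ)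
  have hn : ‖hfL.toLp f‖ ^ 2 = ∫ z, ‖f z‖ ^ 2 ∂μ := by
    have h1 := inner_self_eq_norm_sq_to_K (𝕜 := ℂ) (hfL.toLp f)
    rw [inner_toLp_eq] at h1
    have h2 : ∀ z, conj (f z) * f z = ((‖f z‖ ^ 2 : ℝ) : ℂ) := fun z => by
      rw [Complex.conj_mul']; push_cast; rfl
    simp only [h2, integral_complex_ofReal] at h1
    rw [← RCLike.ofReal_pow] at h1
    exact (Complex.ofReal_injective h1).symm
  rw [hn] at hB
  refine le_trans (le_of_eq ?_) hB
  rw [← Finset.sum_coe_sort s]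
  refine Finset.sum_congr rfl fun i _ => ?_
  rw [inner_toLp_eq]

/-- A quadratic form with bounded kernel, bounded by the square of the `L¹` norm. -/
lemma norm_sum_mul_sq_le (s : Finset ι) {χ : ι → Z → ℂ} (hχ : ∀ i, Measurable (χ i))
    (hχ1 : ∀ i z, ‖χ i z‖ = 1) (β : ι → ℂ) {M : ℝ}
    (hM : ∀ z z', ‖∑ i ∈ s, β i * (χ i z * conj (χ i z'))‖ ≤ M)
    {f : Z → ℂ} (hf : Measurable f) (hf1 : ∀ z, ‖f z‖ ≤ 1) :
    ‖∑ i ∈ s, β i * ((‖∫ z, conj (χ i z) * f z ∂μ‖ ^ 2 : ℝ) : ℂ)‖ ≤ M * (∫ z, ‖f z‖ ∂μ) ^ 2 := by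
  have hfint : Integrable f μ := Integrable.of_bound hf.aestronglyMeasurable 1 (.of_forall hf1)
  have hint : ∀ i, Integrable (fun z => conj (χ i z) * f z) μ := fun i =>
    Integrable.of_bound
      (((Complex.continuous_conj.measurable.comp (hχ i)).mul hf).aestronglyMeasurable) 1
      (.of_forall fun z => by
        change ‖conj (χ i z) * f z‖ ≤ 1
        rw [norm_mul, RCLike.norm_conj, hχ1, one_mul]; exact hf1 z)
  have hint' : ∀ i, Integrable (fun z => χ i z * conj (f z)) μ := fun i => by
    refine Integrable.of_bound
      (((hχ i).mul (Complex.continuous_conj.measurable.comp hf)).aestronglyMeasurable) 1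
      (.of_forall fun z => ?_)
    change ‖χ i z * conj (f z)‖ ≤ 1
    rw [norm_mul, RCLike.norm_conj, hχ1, one_mul]; exact hf1 z
  set c : ι → ℂ := fun i => ∫ z, conj (χ i z) * f z ∂μ with hc
  have hcc : ∀ i, conj (c i) = ∫ z, χ i z * conj (f z) ∂μ := fun i => by
    rw [hc]; dsimp only
    rw [← integral_conj]
    simp
  set G : Z → ℂ := fun z => ∑ i ∈ s, β i * conj (c i) * conj (χ i z) with hG
  have hGle : ∀ z, ‖G z‖ ≤ M * ∫ z, ‖f z‖ ∂μ := by
    intro z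
    -- Unfolding the conjugated coefficients as integrals over a second variable exposes the kernel
    -- bounded in `hM`.
    have e : G z = ∫ z', (∑ i ∈ s, β i * (χ i z' * conj (χ i z))) * conj (f z') ∂μ := by
      simp only [Finset.sum_mul]
      rw [integral_finsetSum]
      · refine Finset.sum_congr rfl fun i _ => ?_
        rw [hcc, ← integral_const_mul, ← integral_mul_const]
        congr 1; funext z'; ring
      · intro i _
        refine ((hint' i).const_mul (β i * conj (χ i z))).congr (.of_forall fun z' => ?_)
        dsimp only; ring
    rw [e, ← integral_const_mul]
    refine norm_integral_le_of_norm_le (hfint.norm.const_mul M) (.of_forall fun z' => ?_)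
    rw [norm_mul, RCLike.norm_conj]
    exact mul_le_mul_of_nonneg_right (hM z' z) (norm_nonneg _)
  have e : ∑ i ∈ s, β i * ((‖c i‖ ^ 2 : ℝ) : ℂ) = ∫ z, G z * f z ∂μ := by
    simp only [hG, Finset.sum_mul]
    rw [integral_finsetSum]
    · refine Finset.sum_congr rfl fun i _ => ?_
      have : ∀ z, β i * conj (c i) * conj (χ i z) * f z =
        β i * conj (c i) * (conj (χ i z) * f z) := fun z => by ring
      simp only [this]
      rw [integral_const_mul, mul_assoc, Complex.conj_mul']
      push_cast; rfl
    · intro i _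
      refine ((hint i).const_mul (β i * conj (c i))).congr (.of_forall fun z' => ?_)
      dsimp only; ring
  rw [e, sq, ← mul_assoc, ← integral_const_mul]
  refine norm_integral_le_of_norm_le (hfint.norm.const_mul _) (.of_forall fun z => ?_)
  rw [norm_mul]
  exact mul_le_mul_of_nonneg_right (hGle z) (norm_nonneg _)

end Bessel

/-! ### Characters of the torus and their orthogonality. -/

instance : IsProbabilityMeasure (volume : Measure UnitAddCircle) := ⟨UnitAddCircle.measure_univ⟩


lemma fourier_index_sub (k l : ℤ) (x : UnitAddCircle) :
    fourier (k - l) x = fourier k x * fourier (-l) x := by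
  rw [sub_eq_add_neg, fourier_add]

lemma fourier_point_sub (k : ℤ) (x y : UnitAddCircle) :
    fourier k (x - y) = fourier k x * conj (fourier k y) := by
  rw [sub_eq_add_neg, fourier_point_add, fourier_point_neg]

variable {d : ℕ}

/-- The characters of `𝕋^d × 𝕋`. -/
noncomputable def torusChar (n : Fin d → ℤ) (m : ℤ) (z : UnitAddTorus (Fin d) × UnitAddCircle) : ℂ :=
  UnitAddTorus.mFourier n z.1 * fourier m z.2

lemma measurable_torusChar (n : Fin d → ℤ) (m : ℤ) : Measurable (torusChar n m) := by
  have : Continuous (torusChar n m) := by unfold torusChar; fun_prop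
  exact this.measurable

lemma torusChar_eq (n : Fin d → ℤ) (m : ℤ) (z : UnitAddTorus (Fin d) × UnitAddCircle) :
    torusChar n m z = (∏ j, fourier (n j) (z.1 j)) * fourier m z.2 := rfl

lemma norm_torusChar (n : Fin d → ℤ) (m : ℤ) (z : UnitAddTorus (Fin d) × UnitAddCircle) :
    ‖torusChar n m z‖ = 1 := by
  rw [torusChar_eq, norm_mul, norm_prod]
  simp only [norm_fourier_apply]
  simp

lemma conj_torusChar_mul (n n' : Fin d → ℤ) (m m' : ℤ)
    (z : UnitAddTorus (Fin d) × UnitAddCircle) :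
    conj (torusChar n m z) * torusChar n' m' z = torusChar (n' - n) (m' - m) z := by
  simp only [torusChar_eq, map_mul, map_prod, ← fourier_neg, Pi.sub_apply, fourier_index_sub,
    Finset.prod_mul_distrib]
  ring

lemma torusChar_mul_conj (n : Fin d → ℤ) (m : ℤ) (z z' : UnitAddTorus (Fin d) × UnitAddCircle) :
    torusChar n m z * conj (torusChar n m z') = torusChar n m (z - z') := by
  simp only [torusChar_eq, map_mul, map_prod, Prod.fst_sub, Prod.snd_sub, Pi.sub_apply,
    fourier_point_sub, Finset.prod_mul_distrib]
  ring

lemma integral_fourier {k : ℤ} (hk : k ≠ 0) : ∫ t : UnitAddCircle, fourier k t = 0 := by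
  -- Translation by `1/(2k)` preserves the integral and changes the sign of the character.
  have hinv := integral_add_right_eq_self (μ := (volume : Measure UnitAddCircle))
    (fun t => (fourier k t : ℂ)) (((1 / 2 / k : ℝ)) : UnitAddCircle)
  have h2 : ∀ t : UnitAddCircle, fourier k (t + ((1 / 2 / k : ℝ) : UnitAddCircle)) =
    -fourier k t := fun t => fourier_add_half_inv_index hk one_pos t
  simp only [h2, integral_neg] at hinv
  exact CharZero.eq_neg_self_iff.1 hinv.symm

lemma integral_torusChar {n : Fin d → ℤ} {m : ℤ} (h : n ≠ 0 ∨ m ≠ 0) :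
    ∫ z, torusChar n m z = 0 := by
  have e : ∫ z, torusChar n m z =
      (∏ j, ∫ t : UnitAddCircle, fourier (n j) t) * ∫ t : UnitAddCircle, fourier m t := by
    rw [← integral_fintype_prod_volume_eq_prod]
    exact integral_prod_mul (μ := (volume : Measure (UnitAddTorus (Fin d))))
      (ν := (volume : Measure UnitAddCircle))
      (fun x => ∏ j, (fourier (n j) (x j) : ℂ)) (fun t => (fourier m t : ℂ))
  rw [e]
  rcases h with h | h
  · obtain ⟨j, hj⟩ := Function.ne_iff.1 h
    rw [Finset.prod_eq_zero (Finset.mem_univ j) (integral_fourier hj), zero_mul]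
  · rw [integral_fourier h, mul_zero]

/-! ### The smoothed Schrödinger kernel on the major arcs. -/

/-- The smooth cutoff weight on frequencies: at least one on `box d N`, supported in `box d (2N)`. -/
noncomputable def cutoff (N : ℕ) (n : Fin d → ℤ) : ℝ := ∏ j, triWeight N (n j) / N

lemma cutoff_nonneg (N : ℕ) (n : Fin d → ℤ) : 0 ≤ cutoff N n :=
  Finset.prod_nonneg fun _ _ => div_nonneg (triWeight_nonneg _ _) (by positivity)

lemma cutoff_le {N : ℕ} (hN : 1 ≤ N) (n : Fin d → ℤ) : cutoff N n ≤ 2 ^ d := by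
  have hN' : (0 : ℝ) < N := by exact_mod_cast hN
  calc cutoff N n ≤ ∏ _j : Fin d, (2 : ℝ) := by
        refine Finset.prod_le_prod (fun j _ => div_nonneg (triWeight_nonneg _ _) hN'.le)
          fun j _ => ?_
        rw [div_le_iff₀ hN']
        exact triWeight_le _ _
    _ = 2 ^ d := by simp

lemma one_le_cutoff {N : ℕ} (hN : 1 ≤ N) {n : Fin d → ℤ} (hn : n ∈ box d N) : 1 ≤ cutoff N n := by
  have hN' : (0 : ℝ) < N := by exact_mod_cast hN
  rw [cutoff, ← Finset.prod_const_one (s := (Finset.univ : Finset (Fin d)))]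
  refine Finset.prod_le_prod (fun _ _ => zero_le_one) fun j _ => ?_
  rw [one_le_div hN']
  have h := Fintype.mem_piFinset.1 hn j
  rw [Finset.mem_Icc, ← abs_le] at h
  have h' : |(n j : ℝ)| ≤ N := by exact_mod_cast h
  exact le_max_of_le_right (by linarith)

lemma box_subset (d N : ℕ) : box d N ⊆ box d (2 * N) := by
  intro n hn
  simp only [box, Fintype.mem_piFinset, Finset.mem_Icc] at hn ⊢
  intro j
  have := hn j
  push_cast
  constructor <;> linarith

/-- The weighted Schrödinger kernel. -/
noncomputable def schrodingerKernel (d N : ℕ) (z : UnitAddTorus (Fin d) × UnitAddCircle) : ℂ :=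
  ∑ n ∈ box d (2 * N), (cutoff N n : ℂ) * torusChar n (∑ j, n j ^ 2) z

lemma fourier_sum {ι : Type*} (s : Finset ι) (k : ι → ℤ) (t : UnitAddCircle) :
    fourier (∑ j ∈ s, k j) t = ∏ j ∈ s, fourier (k j) t := by
  classical
  induction s using Finset.induction_on with
  | empty => simp
  | insert a s ha ih => rw [Finset.sum_insert ha, Finset.prod_insert ha, fourier_add, ih]

/-- Both the cutoff and the phase `|n|²t` split over coordinates, which reduces the kernel bound to
the one-dimensional Weyl sum. -/
lemma schrodingerKernel_eq_prod (N : ℕ) (z : UnitAddTorus (Fin d) × UnitAddCircle) :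
    schrodingerKernel d N z = ∏ j : Fin d, (∑ n ∈ Finset.Icc (-(2 * N : ℤ)) (2 * N),
      (triWeight N n : ℂ) * fourier n (z.1 j) * fourier (n ^ 2) z.2) / N := by
  simp only [Finset.sum_div]
  rw [Finset.prod_univ_sum, schrodingerKernel, box]
  push_cast
  refine Finset.sum_congr rfl fun n _ => ?_
  rw [torusChar_eq, fourier_sum, cutoff, ← Finset.prod_mul_distrib]
  push_cast
  rw [← Finset.prod_mul_distrib]
  refine Finset.prod_congr rfl fun j _ => ?_
  ring

lemma norm_schrodingerKernel_le {N X q : ℕ} (hN : 1 ≤ N) (hNX : N ≤ X) (hqX : q ≤ X)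
    (hXq : X < 8 * q) {a : ℤ} (hcop : IsCoprime a (q : ℤ)) {α : ℝ}
    (hα : |α - a / q| < 1 / (2 * (X : ℝ) ^ 2)) (x : UnitAddTorus (Fin d)) :
    ‖schrodingerKernel d N (x, (α : UnitAddCircle))‖ ≤ √(20000 * X) ^ d := by
  have hN' : (0 : ℝ) < N := by exact_mod_cast hN
  rw [schrodingerKernel_eq_prod, norm_prod]
  calc _ ≤ ∏ _j : Fin d, √(20000 * (X : ℝ)) := by
        refine Finset.prod_le_prod (fun _ _ => norm_nonneg _) fun j _ => ?_
        have h := sq_norm_weyl_sum_le_of_close hN hNX hqX hXq hcop hα (x j)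
        rw [norm_div, Complex.norm_natCast, div_le_iff₀ hN']
        refine le_of_sq_le_sq ?_ (by positivity)
        rw [mul_pow, Real.sq_sqrt (by positivity)]
        refine h.trans_eq ?_
        ring
    _ = _ := by simp

lemma norm_schrodingerKernel_le_sum (N : ℕ) (z : UnitAddTorus (Fin d) × UnitAddCircle) :
    ‖schrodingerKernel d N z‖ ≤ ∑ n ∈ box d (2 * N), cutoff N n := by
  refine norm_sum_le_of_le _ fun n _ => ?_
  rw [norm_mul, norm_torusChar, mul_one, Complex.norm_real, Real.norm_of_nonneg (cutoff_nonneg _ _)]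

lemma norm_kernel_mul_majorArc_le {N X : ℕ} (hN : 1 ≤ N) (hNX : N ≤ X)
    (z : UnitAddTorus (Fin d) × UnitAddCircle) :
    ‖schrodingerKernel d N z * majorArc X z.2‖ ≤ arcWidth X * √(20000 * X) ^ d := by
  have hX : 1 ≤ X := hN.trans hNX
  obtain ⟨x, t⟩ := z
  induction t using QuotientAddGroup.induction_on with | _ α => ?_
  have hr := arcWidth_pos hX
  rcases majorArc_eq_zero_or hX α with h | ⟨h, q, a, hqX, hXq, hcop, hα⟩
  · change ‖_ * majorArc X (α : UnitAddCircle)‖ ≤ _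
    rw [h, mul_zero, norm_zero]; positivity
  · rw [norm_mul, mul_comm]
    exact mul_le_mul h (norm_schrodingerKernel_le hN hNX hqX hXq hcop hα x) (norm_nonneg _) hr.le

/-! ### The restriction estimate. -/

/-- The `L²` restriction bound for a bounded function: the main term uses the major arcs, the error
term uses the decay of the Fourier coefficients of `majorArc X`. -/
lemma sum_sq_coeff_le {N X : ℕ} (hN : 1 ≤ N) (hNX : N ≤ X) {η : ℝ}
    (hη : ∀ k : ℤ, k ≠ 0 → ‖majorArcCoeff X k‖ ≤ arcWidth X * η)
    {f : UnitAddTorus (Fin d) × UnitAddCircle → ℂ} (hf : Measurable f) (hf1 : ∀ z, ‖f z‖ ≤ 1) :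
    3 / 128 * ∑ n ∈ box d N, ‖∫ z, conj (torusChar n (∑ j, n j ^ 2) z) * f z‖ ^ 2 ≤
      2 * √(20000 * X) ^ d * (∫ z, ‖f z‖) ^ 2 + 2 ^ d * η * ∫ z, ‖f z‖ ^ 2 := by
  classical
  have hX : 1 ≤ X := hN.trans hNX
  have hX' : (1 : ℝ) ≤ X := by exact_mod_cast hX
  have hr := arcWidth_pos hX
  set B : ℝ := arcWidth X * √(20000 * X) ^ d with hB
  have hBpos : 0 < B := by positivity
  set K0 : ℝ := ∑ n ∈ box d (2 * N), cutoff N n with hK0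
  have hK0n : 0 ≤ K0 := Finset.sum_nonneg fun n _ => cutoff_nonneg N n
  -- The kernel is at most `K0` everywhere, so with this tolerance truncation costs at most another
  -- `B`.
  obtain ⟨s, h0s, hs⟩ := exists_finset_approx_majorArc hX (δ := B / (K0 + 1)) (by positivity)
  set χ : (Fin d → ℤ) × ℤ → UnitAddTorus (Fin d) × UnitAddCircle → ℂ :=
    fun i => torusChar i.1 (∑ j, i.1 j ^ 2 + i.2) with hχ
  set β : (Fin d → ℤ) × ℤ → ℂ := fun i => (cutoff N i.1 : ℂ) * majorArcCoeff X i.2 with hβ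
  set I := box d (2 * N) ×ˢ s with hI
  set c : (Fin d → ℤ) × ℤ → ℝ := fun i => ‖∫ z, conj (χ i z) * f z‖ ^ 2 with hc
  have hc0 : ∀ i, 0 ≤ c i := fun i => by positivity
  have hker : ∀ z z', ‖∑ i ∈ I, β i * (χ i z * conj (χ i z'))‖ ≤ 2 * B := by
    intro z z'
    set w := z - z' with hw
    have e : ∑ i ∈ I, β i * (χ i z * conj (χ i z')) =
        schrodingerKernel d N w * ∑ k ∈ s, majorArcCoeff X k * fourier k w.2 := by
      rw [hI, Finset.sum_product, schrodingerKernel, Finset.sum_mul_sum]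
      refine Finset.sum_congr rfl fun n _ => Finset.sum_congr rfl fun k _ => ?_
      simp only [hβ, hχ]
      rw [torusChar_mul_conj, torusChar, torusChar, fourier_add]
      ring
    have e2 : schrodingerKernel d N w * ∑ k ∈ s, majorArcCoeff X k * fourier k w.2 =
        schrodingerKernel d N w * majorArc X w.2 - schrodingerKernel d N w *
          (majorArc X w.2 - ∑ k ∈ s, majorArcCoeff X k * fourier k w.2) := by ring
    rw [e, e2]
    refine (norm_sub_le _ _).trans ?_
    have b1 := norm_kernel_mul_majorArc_le hN hNX w
    have b2 : ‖schrodingerKernel d N w *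
        (majorArc X w.2 - ∑ k ∈ s, majorArcCoeff X k * fourier k w.2)‖ ≤ B := by
      rw [norm_mul]
      calc _ ≤ K0 * (B / (K0 + 1)) :=
            mul_le_mul (norm_schrodingerKernel_le_sum N w) (hs w.2).le (norm_nonneg _) hK0n
        _ = K0 / (K0 + 1) * B := by ring
        _ ≤ 1 * B := by
            gcongr
            rw [div_le_one (by positivity)]
            linarith
        _ = B := one_mul B
    linarith
  have hmeas : ∀ i, Measurable (χ i) := fun i => measurable_torusChar _ _
  have hnorm : ∀ i z, ‖χ i z‖ = 1 := fun i z => norm_torusChar _ _ _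
  have hmain := norm_sum_mul_sq_le (μ := volume) I hmeas hnorm β hker hf hf1
  -- The frequencies `(n, |n|² + k)` determine `(n, k)`, so these characters are orthonormal.
  have hbessel : ∑ i ∈ I, c i ≤ ∫ z, ‖f z‖ ^ 2 := by
    refine sum_sq_norm_integral_le I hmeas hnorm (fun i _ j _ hij => ?_) hf hf1
    simp only [hχ, conj_torusChar_mul]
    apply integral_torusChar
    by_contra! h
    obtain ⟨h1, h2⟩ := h
    have h3 : j.1 = i.1 := sub_eq_zero.1 h1
    rw [h3] at h2
    exact hij (Prod.ext h3.symm (by linarith))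
  -- The terms `k = 0` are exactly the frequencies on the paraboloid; their common factor is the
  -- mean of `majorArc X`.
  have hsplit : ∑ i ∈ I, β i * (c i : ℂ) =
      ((arcWidth X ^ 2 * (farey X).card * ∑ n ∈ box d (2 * N), cutoff N n * c (n, 0) : ℝ) : ℂ) +
      ∑ i ∈ box d (2 * N) ×ˢ s.erase 0, β i * (c i : ℂ) := by
    rw [hI, Finset.sum_product, Finset.sum_product, Complex.ofReal_mul, Complex.ofReal_sum,
      Finset.mul_sum, ← Finset.sum_add_distrib]
    refine Finset.sum_congr rfl fun n _ => ?_
    rw [← Finset.add_sum_erase s _ h0s]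
    simp only [hβ, majorArcCoeff_zero]
    push_cast
    ring
  have herr : ‖∑ i ∈ box d (2 * N) ×ˢ s.erase 0, β i * (c i : ℂ)‖ ≤
      arcWidth X * (2 ^ d * η * ∫ z, ‖f z‖ ^ 2) := by
    have hle : ‖∑ i ∈ box d (2 * N) ×ˢ s.erase 0, β i * (c i : ℂ)‖ ≤
        ∑ i ∈ box d (2 * N) ×ˢ s.erase 0, (2 ^ d * (arcWidth X * η)) * c i := by
      refine norm_sum_le_of_le _ fun i hi => ?_
      have hi2 : i.2 ≠ 0 := (Finset.mem_erase.1 (Finset.mem_product.1 hi).2).1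
      rw [norm_mul, Complex.norm_real, Real.norm_of_nonneg (hc0 i), hβ]
      dsimp only
      rw [norm_mul, Complex.norm_real, Real.norm_of_nonneg (cutoff_nonneg _ _)]
      refine mul_le_mul_of_nonneg_right ?_ (hc0 i)
      exact mul_le_mul (cutoff_le hN _) (hη _ hi2) (norm_nonneg _) (by positivity)
    have hη0 : 0 ≤ arcWidth X * η := (norm_nonneg _).trans (hη 1 one_ne_zero)
    rw [← Finset.mul_sum] at hle
    calc _ ≤ _ := hle
      _ ≤ (2 ^ d * (arcWidth X * η)) * ∫ z, ‖f z‖ ^ 2 := by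
          refine mul_le_mul_of_nonneg_left (le_trans ?_ hbessel) (by positivity)
          exact Finset.sum_le_sum_of_subset_of_nonneg
            (Finset.product_subset_product_right (Finset.erase_subset _ _)) fun i _ _ => hc0 i
      _ = _ := by ring
  set A : ℝ := ∑ n ∈ box d (2 * N), cutoff N n * c (n, 0) with hA
  have hAle : ∑ n ∈ box d N, ‖∫ z, conj (torusChar n (∑ j, n j ^ 2) z) * f z‖ ^ 2 ≤ A := by
    calc _ = ∑ n ∈ box d N, c (n, 0) := by
          refine Finset.sum_congr rfl fun n _ => ?_
          change _ = ‖∫ z, conj (torusChar n (∑ j, n j ^ 2 + 0) z) * f z‖ ^ 2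
          rw [add_zero]
      _ ≤ ∑ n ∈ box d N, cutoff N n * c (n, 0) := Finset.sum_le_sum fun n hn =>
          le_mul_of_one_le_left (hc0 _) (one_le_cutoff hN hn)
      _ ≤ A := Finset.sum_le_sum_of_subset_of_nonneg (box_subset d N) fun n _ _ =>
          mul_nonneg (cutoff_nonneg _ _) (hc0 _)
  have hA0 : 0 ≤ A := Finset.sum_nonneg fun n _ => mul_nonneg (cutoff_nonneg _ _) (hc0 _)
  have hAb : arcWidth X ^ 2 * (farey X).card * A ≤
      2 * B * (∫ z, ‖f z‖) ^ 2 + arcWidth X * (2 ^ d * η * ∫ z, ‖f z‖ ^ 2) := by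
    have e : ((arcWidth X ^ 2 * (farey X).card * A : ℝ) : ℂ) =
        ∑ i ∈ I, β i * (c i : ℂ) - ∑ i ∈ box d (2 * N) ×ˢ s.erase 0, β i * (c i : ℂ) := by
      rw [hsplit]; ring
    have e' := congrArg norm e
    rw [Complex.norm_real, Real.norm_of_nonneg
      (mul_nonneg (mul_nonneg (sq_nonneg _) (Nat.cast_nonneg _)) hA0)] at e'
    rw [e']
    exact (norm_sub_le _ _).trans (add_le_add hmain herr)
  have hfin : arcWidth X * (3 / 128 * A) ≤ arcWidth X *
      (2 * √(20000 * X) ^ d * (∫ z, ‖f z‖) ^ 2 + 2 ^ d * η * ∫ z, ‖f z‖ ^ 2) := by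
    have h1 := mul_le_mul_of_nonneg_right (le_arcWidth_sq_mul_card hX) hA0
    rw [hB] at hAb
    linarith
  have := le_of_mul_le_mul_left hfin hr
  linarith

/-! ### From restriction to level sets. -/

lemma extension_eq (N : ℕ) (a : (Fin d → ℤ) → ℂ) (z : UnitAddTorus (Fin d) × UnitAddCircle) :
    extension d N a z = ∑ n ∈ box d N, a n * torusChar n (∑ j, n j ^ 2) z :=
  Finset.sum_congr rfl fun _ _ => by rw [torusChar, mul_assoc]

lemma measurable_extension (N : ℕ) (a : (Fin d → ℤ) → ℂ) : Measurable (extension d N a) := by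
  have : extension d N a = fun z => ∑ n ∈ box d N, a n * torusChar n (∑ j, n j ^ 2) z :=
    funext (extension_eq N a)
  rw [this]
  exact Finset.measurable_sum _ fun n _ => (measurable_torusChar _ _).const_mul _

lemma sq_norm_extension_le (N : ℕ) {a : (Fin d → ℤ) → ℂ} (ha : ∑ n ∈ box d N, ‖a n‖ ^ 2 = 1)
    (z : UnitAddTorus (Fin d) × UnitAddCircle) : ‖extension d N a z‖ ^ 2 ≤ (2 * N + 1) ^ d := by
  have h1 : ‖extension d N a z‖ ≤ ∑ n ∈ box d N, ‖a n‖ * 1 := by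
    rw [extension_eq]
    refine norm_sum_le_of_le _ fun n _ => ?_
    rw [norm_mul, norm_torusChar]
  calc _ ≤ (∑ n ∈ box d N, ‖a n‖ * 1) ^ 2 := by gcongr
    _ ≤ (∑ n ∈ box d N, ‖a n‖ ^ 2) * ∑ n ∈ box d N, (1 : ℝ) ^ 2 :=
        Finset.sum_mul_sq_le_sq_mul_sq _ _ _
    _ = (2 * N + 1) ^ d := by
        rw [ha, one_mul]
        simp only [one_pow, Finset.sum_const, nsmul_eq_mul, mul_one, box, Fintype.card_piFinset,
          Int.card_Icc, Finset.prod_const, Finset.card_univ, Fintype.card_fin]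
        rw [show (N + 1 - -N : ℤ) = ((2 * N + 1 : ℕ) : ℤ) by push_cast; ring, Int.toNat_natCast]
        push_cast; rfl

/-- Level set estimate in terms of the auxiliary scale `X ≥ N`. -/
lemma measureReal_levelSet_mul_le {N X : ℕ} (hN : 1 ≤ N) (hNX : N ≤ X) {η : ℝ}
    (hη : ∀ k : ℤ, k ≠ 0 → ‖majorArcCoeff X k‖ ≤ arcWidth X * η) {a : (Fin d → ℤ) → ℂ}
    (ha : ∑ n ∈ box d N, ‖a n‖ ^ 2 = 1) {lam : ℝ} (hlam : 0 < lam)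
    (hX : 512 / 3 * √(20000 * X) ^ d ≤ lam ^ 2) :
    volume.real (levelSet d N a lam) * lam ^ 2 ≤ 256 / 3 * 2 ^ d * η := by
  classical
  set E := levelSet d N a lam with hE
  have hFm := measurable_extension N a
  have hEm : MeasurableSet E := measurableSet_lt measurable_const hFm.norm
  set F := extension d N a with hF
  -- The phase of `F` on `E`: `conj F * f = |F|` there, while `‖f‖` is the indicator of `E`, so both
  -- norms of `f` are powers of `|E|`.
  set f : UnitAddTorus (Fin d) × UnitAddCircle → ℂ :=
    E.indicator fun z => F z / (‖F z‖ : ℂ) with hf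
  have hfm : Measurable f :=
    (hFm.div (Complex.measurable_ofReal.comp hFm.norm)).indicator hEm
  have hfn : ∀ z, ‖f z‖ = E.indicator (fun _ => (1 : ℝ)) z := by
    intro z
    by_cases hz : z ∈ E
    · have hpos : 0 < ‖F z‖ := hlam.trans hz
      rw [hf, Set.indicator_of_mem hz, Set.indicator_of_mem hz, norm_div, Complex.norm_real,
        norm_norm, div_self hpos.ne']
    · rw [hf, Set.indicator_of_notMem hz, Set.indicator_of_notMem hz, norm_zero]
  have hf1 : ∀ z, ‖f z‖ ≤ 1 := fun z => by
    rw [hfn]; exact Set.indicator_le_self' (fun _ _ => zero_le_one) z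
  have hint1 : ∫ z, ‖f z‖ = volume.real E := by
    simp only [hfn]
    exact integral_indicator_one hEm
  have hint2 : ∫ z, ‖f z‖ ^ 2 = volume.real E := by
    rw [← hint1]
    congr 1; funext z
    rw [hfn]
    by_cases hz : z ∈ E <;> simp [hz]
  have hfint : Integrable f := Integrable.of_bound hfm.aestronglyMeasurable 1 (.of_forall hf1)
  set c : (Fin d → ℤ) → ℂ := fun n => ∫ z, conj (torusChar n (∑ j, n j ^ 2) z) * f z with hc
  have hpair : ∫ z, conj (F z) * f z = ∑ n ∈ box d N, conj (a n) * c n := by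
    have e : ∀ z, conj (F z) * f z =
        ∑ n ∈ box d N, conj (a n) * (conj (torusChar n (∑ j, n j ^ 2) z) * f z) := by
      intro z
      rw [hF, extension_eq, map_sum, Finset.sum_mul]
      refine Finset.sum_congr rfl fun n _ => ?_
      rw [map_mul, mul_assoc]
    simp only [e]
    rw [integral_finsetSum]
    · exact Finset.sum_congr rfl fun n _ => integral_const_mul _ _
    · intro n _
      refine Integrable.const_mul ?_ _
      refine Integrable.of_bound ((Complex.continuous_conj.measurable.comp
        (measurable_torusChar _ _)).mul hfm).aestronglyMeasurable 1 (.of_forall fun z => ?_)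
      change ‖conj (torusChar n (∑ j, n j ^ 2) z) * f z‖ ≤ 1
      rw [norm_mul, RCLike.norm_conj, norm_torusChar, one_mul]
      exact hf1 z
  have hlow : lam * volume.real E ≤ ‖∫ z, conj (F z) * f z‖ := by
    have e : ∀ z, conj (F z) * f z = ((E.indicator (fun z => ‖F z‖) z : ℝ) : ℂ) := by
      intro z
      by_cases hz : z ∈ E
      · have hpos : 0 < ‖F z‖ := hlam.trans hz
        have hne : (‖F z‖ : ℂ) ≠ 0 := by exact_mod_cast hpos.ne'
        rw [hf, Set.indicator_of_mem hz, Set.indicator_of_mem hz, mul_div_assoc',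
          Complex.conj_mul', sq, mul_div_assoc, div_self hne, mul_one]
      · rw [hf, Set.indicator_of_notMem hz, Set.indicator_of_notMem hz]; simp
    have hFi : Integrable (E.indicator fun z => ‖F z‖) := by
      refine Integrable.indicator ?_ hEm
      refine Integrable.of_bound hFm.norm.aestronglyMeasurable (((2 * N + 1) ^ d : ℝ) + 1)
        (.of_forall fun z => ?_)
      rw [norm_norm]
      nlinarith [sq_norm_extension_le N ha z, sq_nonneg (‖F z‖ - 1)]
    simp only [e]
    rw [integral_complex_ofReal, Complex.norm_real]
    refine le_trans ?_ (le_abs_self _)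
    rw [← hint1, ← integral_const_mul]
    refine integral_mono (hfint.norm.const_mul _) hFi fun z => ?_
    dsimp only
    rw [hfn]
    by_cases hz : z ∈ E
    · rw [Set.indicator_of_mem hz, Set.indicator_of_mem hz, mul_one]; exact le_of_lt hz
    · rw [Set.indicator_of_notMem hz, Set.indicator_of_notMem hz, mul_zero]
  have hCS : (lam * volume.real E) ^ 2 ≤ ∑ n ∈ box d N, ‖c n‖ ^ 2 := by
    have h1 : lam * volume.real E ≤ ∑ n ∈ box d N, ‖a n‖ * ‖c n‖ := by
      refine hlow.trans ?_
      rw [hpair]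
      refine norm_sum_le_of_le _ fun n _ => ?_
      rw [norm_mul, RCLike.norm_conj]
    calc _ ≤ (∑ n ∈ box d N, ‖a n‖ * ‖c n‖) ^ 2 := by gcongr
      _ ≤ (∑ n ∈ box d N, ‖a n‖ ^ 2) * ∑ n ∈ box d N, ‖c n‖ ^ 2 :=
          Finset.sum_mul_sq_le_sq_mul_sq _ _ _
      _ = _ := by rw [ha, one_mul]
  have hmain := sum_sq_coeff_le hN hNX hη hfm hf1
  rw [hint1, hint2] at hmain
  set m := volume.real E with hm
  have hm0 : 0 ≤ m := measureReal_nonneg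
  -- The constant `512/3` in `hX` makes the first term half of the left side, so it can be absorbed.
  have h1 : 3 / 128 * (lam * m) ^ 2 ≤ 3 / 256 * lam ^ 2 * m ^ 2 + 2 ^ d * η * m := by
    calc _ ≤ 3 / 128 * ∑ n ∈ box d N, ‖c n‖ ^ 2 := by gcongr
      _ ≤ _ := hmain
      _ ≤ _ := by
        have : 2 * √(20000 * X) ^ d ≤ 3 / 256 * lam ^ 2 := by linarith
        gcongr
  rcases hm0.eq_or_lt with h0 | h0
  · rw [← h0, zero_mul]
    have := (norm_nonneg _).trans (hη 1 one_ne_zero)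
    have hη0 : 0 ≤ η := nonneg_of_mul_nonneg_right this (arcWidth_pos (hN.trans hNX))
    positivity
  · have h2 : m * (m * lam ^ 2) ≤ m * (256 / 3 * 2 ^ d * η) := by linarith
    exact le_of_mul_le_mul_left h2 h0

/-- Real-variable form of the level set estimate. -/
lemma exists_measureReal_levelSet_le (hd : 1 ≤ d) {κ : ℝ} (hκ : 0 < κ)
    (hκA : ∀ lam X : ℝ, 0 < lam → 0 ≤ X → X ≤ κ * lam ^ (4 / (d : ℝ)) →
      512 / 3 * √(20000 * X) ^ d ≤ lam ^ 2) (hκ1 : κ ≤ 1) {ε : ℝ} (hε : 0 < ε) :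
    ∃ C₁ : ℝ, 0 < C₁ ∧ ∀ N : ℕ, 1 ≤ N → ∀ a : (Fin d → ℤ) → ℂ,
      ∑ n ∈ box d N, ‖a n‖ ^ 2 = 1 → ∀ lam : ℝ, 0 < lam →
        (N : ℝ) ≤ κ * lam ^ (4 / (d : ℝ)) →
        volume.real (levelSet d N a lam) ≤
          C₁ * (N : ℝ) ^ ε * lam ^ (-(2 * ((d : ℝ) + 2) / (d : ℝ))) := by
  have hd0 : (0 : ℝ) < d := by exact_mod_cast hd
  -- The loss `X^{2δ}` with `X ≤ 9N²` becomes `N^{4δ}`.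
  set δ := min (ε / 4) 1 with hδdef
  have hδ : 0 < δ := lt_min (by positivity) one_pos
  have hδ1 : δ ≤ 1 := min_le_right _ _
  have hδε : 4 * δ ≤ ε := by linarith [min_le_left (ε / 4) 1]
  obtain ⟨D, hD1, hD⟩ := exists_card_divisors_le hδ
  have hD0 : 0 < D := by linarith
  refine ⟨256 / 3 * 2 ^ d * (2 * D * 81 * (2 / κ)), by positivity, fun N hN a ha lam hlam hle => ?_⟩
  have hN' : (1 : ℝ) ≤ N := by exact_mod_cast hN
  have hN0 : (0 : ℝ) < N := by linarith
  set L := lam ^ (4 / (d : ℝ)) with hL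
  have hL0 : 0 < L := Real.rpow_pos_of_pos hlam _
  rcases (levelSet d N a lam).eq_empty_or_nonempty with hemp | ⟨z, hz⟩
  · rw [hemp, measureReal_empty]; positivity
  -- A nonempty level set forces `λ² < (2N+1)^d` by Cauchy–Schwarz; this bounds `X` by a power of
  -- `N`, so the loss can be stated as `N^ε`.
  have hL9 : L ≤ 9 * (N : ℝ) ^ 2 := by
    have h1 : lam ^ 2 ≤ (3 * (N : ℝ)) ^ d := by
      calc lam ^ 2 ≤ ‖extension d N a z‖ ^ 2 := by gcongr; exact le_of_lt hz
        _ ≤ (2 * (N : ℝ) + 1) ^ d := sq_norm_extension_le N ha z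
        _ ≤ (3 * (N : ℝ)) ^ d := by gcongr; linarith
    have h2 : L = (lam ^ 2) ^ (2 / (d : ℝ)) := by
      rw [← Real.rpow_natCast, ← Real.rpow_mul hlam.le, hL]; congr 1; push_cast; ring
    calc L ≤ ((3 * (N : ℝ)) ^ d) ^ (2 / (d : ℝ)) := by rw [h2]; gcongr
      _ = (3 * (N : ℝ)) ^ (2 : ℝ) := by
          rw [← Real.rpow_natCast, ← Real.rpow_mul (by positivity)]; congr 1; field_simp
      _ = _ := by rw [Real.rpow_two]; ring
  set X := ⌊κ * L⌋₊ with hX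
  have hXle : (X : ℝ) ≤ κ * L := Nat.floor_le (by positivity)
  have hNX : N ≤ X := Nat.le_floor hle
  have hX1 : 1 ≤ X := hN.trans hNX
  have hX1' : (1 : ℝ) ≤ X := by exact_mod_cast hX1
  -- Rounding down loses at most a factor 2 since `X ≥ 1`.
  have hXge : κ * L / 2 ≤ X := by linarith [Nat.lt_floor_add_one (κ * L)]
  have hXN : (X : ℝ) ≤ 9 * N ^ 2 := by nlinarith
  have hpow : ((X : ℝ) ^ 2) ^ δ ≤ 81 * (N : ℝ) ^ ε := by
    calc ((X : ℝ) ^ 2) ^ δ ≤ ((9 * (N : ℝ) ^ 2) ^ 2) ^ δ := by gcongr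
      _ = (81 : ℝ) ^ δ * (N : ℝ) ^ (4 * δ) := by
          rw [show (9 * (N : ℝ) ^ 2) ^ 2 = 81 * (N : ℝ) ^ 4 by ring,
            Real.mul_rpow (by norm_num) (by positivity), Real.rpow_mul hN0.le]
          norm_num
      _ ≤ (81 : ℝ) ^ (1 : ℝ) * (N : ℝ) ^ ε := by
          gcongr
          norm_num
      _ = _ := by rw [Real.rpow_one]
  have hkey := measureReal_levelSet_mul_le hN hNX
    (fun k hk => norm_majorArcCoeff_le hδ hδ1 hD hX1 hk) ha hlam
    (hκA lam X hlam (by positivity) hXle)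
  have hη : 2 * D * ((X : ℝ) ^ 2) ^ δ / X ≤ 2 * D * 81 * (2 / κ) * (N : ℝ) ^ ε / L := by
    calc _ ≤ 2 * D * (81 * (N : ℝ) ^ ε) / (κ * L / 2) := by gcongr
      _ = _ := by field_simp
  have hexp : lam ^ (-(2 * ((d : ℝ) + 2) / (d : ℝ))) = 1 / L / lam ^ 2 := by
    have : -(2 * ((d : ℝ) + 2) / (d : ℝ)) = -(4 / (d : ℝ)) - (2 : ℕ) := by
      push_cast; field_simp; ring
    rw [this, Real.rpow_sub hlam, Real.rpow_neg hlam.le, Real.rpow_natCast, one_div]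
  rw [hexp, ← mul_div_assoc, le_div_iff₀ (by positivity)]
  refine hkey.trans ?_
  calc _ ≤ 256 / 3 * 2 ^ d * (2 * D * 81 * (2 / κ) * (N : ℝ) ^ ε / L) := by gcongr
    _ = _ := by ring

lemma sqrt_pow_le {κ A : ℝ} (hd : 1 ≤ d) (hA : 0 < A) (hκ : κ = 1 / (20000 * A ^ (2 / (d : ℝ))))
    {lam X : ℝ} (hlam : 0 < lam) (hX0 : 0 ≤ X) (hX : X ≤ κ * lam ^ (4 / (d : ℝ))) :
    A * √(20000 * X) ^ d ≤ lam ^ 2 := by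
  have hd0 : (0 : ℝ) < d := by exact_mod_cast hd
  have hAp : 0 < A ^ (2 / (d : ℝ)) := Real.rpow_pos_of_pos hA _
  have e1 : √(20000 * X) ^ d = (20000 * X) ^ ((d : ℝ) / 2) := by
    rw [Real.sqrt_eq_rpow, ← Real.rpow_natCast, ← Real.rpow_mul (by positivity)]
    congr 1; ring
  have e2 : 20000 * X ≤ lam ^ (4 / (d : ℝ)) / A ^ (2 / (d : ℝ)) := by
    calc 20000 * X ≤ 20000 * (κ * lam ^ (4 / (d : ℝ))) := by gcongr
      _ = _ := by rw [hκ]; field_simp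
  rw [e1]
  calc _ ≤ A * (lam ^ (4 / (d : ℝ)) / A ^ (2 / (d : ℝ))) ^ ((d : ℝ) / 2) := by gcongr
    _ = A * (lam ^ (2 : ℝ) / A ^ (1 : ℝ)) := by
        rw [Real.div_rpow (by positivity) hAp.le, ← Real.rpow_mul hlam.le, ← Real.rpow_mul hA.le]
        congr 3 <;> · field_simp; try norm_num
    _ = lam ^ 2 := by rw [Real.rpow_one, Real.rpow_two]; field_simp

end SchrodingerRestriction

theorem corollary1 (d : ℕ) (hd : 1 ≤ d) :
    ∃ C : ℝ, 0 < C ∧ ∀ ε : ℝ, 0 < ε → ∃ C₁ : ℝ, 0 < C₁ ∧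
      ∀ N : ℕ, 1 ≤ N → ∀ a : (Fin d → ℤ) → ℂ,
        ∑ n ∈ SchrodingerRestriction.box d N, ‖a n‖ ^ 2 = 1 →
        ∀ lam : ℝ, C * (N : ℝ) ^ ((d : ℝ) / 4) ≤ lam →
          volume (SchrodingerRestriction.levelSet d N a lam) ≤
            ENNReal.ofReal
              (C₁ * (N : ℝ) ^ ε * lam ^ (-(2 * ((d : ℝ) + 2) / (d : ℝ)))) := by
  have hd0 : (0 : ℝ) < d := by exact_mod_cast hd
  set κ : ℝ := 1 / (20000 * (512 / 3 : ℝ) ^ (2 / (d : ℝ))) with hκ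
  have hA1 : (1 : ℝ) ≤ (512 / 3 : ℝ) ^ (2 / (d : ℝ)) :=
    Real.one_le_rpow (by norm_num) (by positivity)
  have hκ0 : 0 < κ := by positivity
  have hκ1 : κ ≤ 1 := by
    rw [hκ, div_le_one (by positivity)]; linarith
  -- With this `C`, the condition `λ ≥ C N^{d/4}` is equivalent to `N ≤ κ λ^{4/d}`, and `κ` depends
  -- only on `d`.
  refine ⟨κ ^ (-((d : ℝ) / 4)), Real.rpow_pos_of_pos hκ0 _, fun ε hε => ?_⟩
  obtain ⟨C₁, hC₁, h⟩ := SchrodingerRestriction.exists_measureReal_levelSet_le hd hκ0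
    (fun lam X hlam hX0 hX => SchrodingerRestriction.sqrt_pow_le hd (by norm_num) hκ hlam hX0 hX) hκ1 hε
  refine ⟨C₁, hC₁, fun N hN a ha lam hlam => ?_⟩
  have hN0 : (0 : ℝ) < N := by exact_mod_cast hN
  have hlam0 : 0 < lam := lt_of_lt_of_le (by positivity) hlam
  have hNle : (N : ℝ) ≤ κ * lam ^ (4 / (d : ℝ)) := by
    have h1 : (κ ^ (-((d : ℝ) / 4)) * (N : ℝ) ^ ((d : ℝ) / 4)) ^ (4 / (d : ℝ)) = κ⁻¹ * N := by
      rw [Real.mul_rpow (by positivity) (by positivity), ← Real.rpow_mul hκ0.le,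
        ← Real.rpow_mul hN0.le, ← Real.rpow_neg_one]
      have : (d : ℝ) / 4 * (4 / d) = 1 := by field_simp
      rw [neg_mul, this, Real.rpow_one]
    calc (N : ℝ) = κ * (κ⁻¹ * N) := by field_simp
      _ ≤ _ := by rw [← h1]; gcongr
  rw [← ENNReal.ofReal_toReal (measure_ne_top volume (SchrodingerRestriction.levelSet d N a lam))]
  exact ENNReal.ofReal_le_ofReal (h N hN a ha lam hlam0 hNle)
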